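/- Let $\alpha,q\in(-1,1)$ and write $[n]_q=1+q+\dots+q^{n-1}$. Let $H$ be a complex Hilbert space (inner product linear on the right) with a bounded linear selfadjoint involution $x\mapsto\bar x$. \textbf{Fock space of type B.} Let $\Sigma(n)$ be the group of the bijections $\sigma$ of $\{\pm1,\dots,\pm n\}$ with $\sigma(-k)=-\sigma(k)$, generated by $\pi_0=(1,-1)$ and $\pi_i=(i,i+1)$, $1\le i\le n-1$; it acts on the tensor power $H^{\otimes n}$, where $\pi_0$ replaces $x_1$ by $\bar x_1$ and $\pi_i$ exchanges $x_i$ and $x_{i+1}$. Let $l_1(\sigma)$ and $l_2(\sigma)$ be the numbers of letters $\pi_0$, respectively $\pi_i$ with $i\ge1$, in a reduced word of $\sigma$, and let $P^{(n)}_{\alpha,q}=\sum_{\sigma\in\Sigma(n)}\alpha^{l_1(\sigma)}q^{l_2(\sigma)}\sigma$. On the algebraic Fock space $\bigoplus_{n\ge0}H^{\otimes n}$, with $H^{\otimes 0}=\mathbb C\Omega$, let $\langle f,g\rangle_{\alpha,q}=\sum_n\langle f_n,P^{(n)}_{\alpha,q}g_n\rangle$, where on $H^{\otimes n}$ the form $\langle\cdot,\cdot\rangle$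 is given by $\langle x_1\otimes\dots\otimes x_n,y_1\otimes\dots\otimes y_n\rangle=\prod_i\langle x_i,y_i\rangle$. \textbf{Operators.} For $x\in H$ let $b_{\alpha,q}(x)\Omega=0$ and, for $n\ge1$, $$b_{\alpha,q}(x)(x_1\otimes\dots\otimes x_n)=\sum_{k=1}^n\bigl(q^{n-k}\langle x,x_k\rangle+\alpha q^{n-1}q^{k-1}\langle x,\bar x_k\rangle\bigr)\,x_1\otimes\dots\otimes\check x_k\otimes\dots\otimes x_n ,$$ where $\check x_k$ means that $x_k$ is omitted. Let $b^*_{\alpha,q}(x)$ be the operator $x_1\otimes\dots\otimes x_n\mapsto x_1\otimes\dots\otimes x_n\otimes x$, $\Omega\mapsto x$. For a bounded selfadjoint operator $T$ on $H$ let the gauge operator be given by $p(T)\Omega=0$ and $p(T)=p_0(T)R^{(n)}_{\alpha,q}$ on $H^{\otimes n}$, $n\ge1$, where $p_0(T)$ applies $T$ to the last tensor factor and $$R^{(n)}_{\alpha,q}=1+\sum_{k=1}^{n-1}q^k\pi_{n-1}\cdots\pi_{n-k}+\alpha q^{n-1}\pi_{n-1}\cdots\pi_1\pi_0\Bigl(1+\sum_{k=1}^{n-1}q^k\pi_1\cdots\pi_k\Bigr).$$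 Let $\mathcal B_{\alpha,q}(x)=b_{\alpha,q}(x)+b^*_{\alpha,q}(x)+p(T)$. A probability measure $\mu$ on $\mathbb R$ with finite moments is a distribution of an operator $X$ in the vacuum state if $\langle\Omega,X^n\Omega\rangle_{\alpha,q}=\int y^n\,d\mu(y)$ for all $n\ge0$. \textbf{Polynomials.} The $(\alpha,q)$-Poisson polynomials of type B are given by $P^{(\alpha,q)}_0=1$, $P^{(\alpha,q)}_1(y)=y$ and $$yP^{(\alpha,q)}_n(y)=P^{(\alpha,q)}_{n+1}(y)+[n]_q(1+\alpha q^{n-1})P^{(\alpha,q)}_n(y)+[n]_q(1+\alpha q^{n-1})P^{(\alpha,q)}_{n-1}(y),\qquad n\ge1 .$$ \textbf{Proposition.} Let $x\in H$ with $\|x\|=1$ and $\bar x=\pm x$, and let $T=\mathrm{Id}$. Then $b^*_{\alpha,q}(x)$ is adjoint to $b_{\alpha,q}(x)$ with respect to $\langle\cdot,\cdot\rangle_{\alpha,q}$, and the following holds. (1) If $\bar x=x$, then there is exactly one probability measure $\mu_{\alpha,q}$ on $\mathbb R$ with finite moments for which the polynomials $P^{(\alpha,q)}_n$, $n\ge0$,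 are pairwise orthogonal, and $\mu_{\alpha,q}$ is the unique distribution of $\mathcal B_{\alpha,q}(x)$ in the vacuum state. (2) If $\bar x=-x$, then there is exactly one such measure $\mu_{-\alpha,q}$ for the polynomials $P^{(-\alpha,q)}_n$, and $\mu_{-\alpha,q}$ is the unique distribution of $\mathcal B_{\alpha,q}(x)$ in the vacuum state. -/

import Mathlib

open scoped TensorProduct

noncomputable section

namespace TypeB

/-! ### The hyperoctahedral group -/

/-- The map `k ↦ -k` on the `2n` points `±1, …, ±n`. The point `±(i+1)` is encoded as the pair
`(i, ±1)` with `i : Fin n`. -/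
def negPerm (n : ℕ) : Equiv.Perm (Fin n × ℤˣ) :=
  Equiv.prodCongr (Equiv.refl (Fin n)) (Equiv.neg ℤˣ)

/-- The group `Σ(n)` of the bijections `σ` of `{±1, …, ±n}` with `σ(-k) = -σ(k)`, that is, the
bijections which commute with `k ↦ -k`. -/
abbrev SignedPerm (n : ℕ) : Type := Subgroup.centralizer ({negPerm n} : Set (Equiv.Perm (Fin n × ℤˣ)))

lemma signedPerm_neg {n : ℕ} (σ : SignedPerm n) (k : Fin n) (s : ℤˣ) :
    σ.1 (k, -s) = ((σ.1 (k, s)).1, -(σ.1 (k, s)).2) := by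
  have h := Subgroup.mem_centralizer_iff.1 σ.2 (negPerm n) rfl
  have h2 := congrArg (fun e : Equiv.Perm (Fin n × ℤˣ) => e (k, s)) h
  exact h2.symm

lemma signedPerm_fst {n : ℕ} (σ : SignedPerm n) (k : Fin n) (s : ℤˣ) :
    (σ.1 (k, s)).1 = (σ.1 (k, 1)).1 := by
  rcases Int.units_eq_one_or s with rfl | rfl
  · rfl
  · rw [signedPerm_neg]

lemma signedPerm_abs_inv {n : ℕ} (σ : SignedPerm n) (k : Fin n) :
    ((σ⁻¹).1 ((σ.1 (k, 1)).1, 1)).1 = k := by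
  rw [← signedPerm_fst σ⁻¹ _ (σ.1 (k, 1)).2]
  change (σ.1⁻¹ (σ.1 (k, 1))).1 = k
  exact congrArg Prod.fst (σ.1.symm_apply_apply (k, 1))

/-- The permutation `i ↦ |σ(i)|` underlying a signed permutation. -/
def absPerm {n : ℕ} (σ : SignedPerm n) : Equiv.Perm (Fin n) where
  toFun k := (σ.1 (k, 1)).1
  invFun k := ((σ⁻¹).1 (k, 1)).1
  left_inv k := signedPerm_abs_inv σ k
  right_inv k := by
    have h := signedPerm_abs_inv σ⁻¹ k
    rwa [inv_inv] at h

/-- The generators as bijections of `{±1, …, ±n}`: `π₀ = (1, -1)` for `i = 0`, and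
`πᵢ = (i, i+1)` (which also exchanges `-i` and `-(i+1)`) for `1 ≤ i ≤ n - 1`. -/
def genPerm (n : ℕ) (i : Fin n) : Equiv.Perm (Fin n × ℤˣ) :=
  if i.val = 0 then Equiv.swap (i, 1) (i, -1)
  else Equiv.prodCongr (Equiv.swap ⟨i.val - 1, by omega⟩ i) (Equiv.refl ℤˣ)

lemma genPerm_mem (n : ℕ) (i : Fin n) :
    genPerm n i ∈ Subgroup.centralizer ({negPerm n} : Set (Equiv.Perm (Fin n × ℤˣ))) := by
  rw [Subgroup.mem_centralizer_iff]
  rintro _ rfl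
  unfold genPerm
  split_ifs with h
  · ext1 ⟨k, s⟩
    by_cases hk : k = i
    · subst hk
      rcases Int.units_eq_one_or s with rfl | rfl <;> simp [negPerm]
    · have h1 : ∀ t : ℤˣ, Equiv.swap ((i, 1) : Fin n × ℤˣ) (i, -1) (k, t) = (k, t) := fun t =>
        Equiv.swap_apply_of_ne_of_ne (by simp [hk]) (by simp [hk])
      simp [negPerm, h1]
  · ext1 ⟨k, s⟩
    simp [negPerm]

/-- The generators `π₀, …, π_{n-1}` of `Σ(n)`. -/
def gen (n : ℕ) (i : Fin n) : SignedPerm n := ⟨genPerm n i, genPerm_mem n i⟩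

/-- `w` is an expression of `σ` of minimal length as a product of generators. -/
def IsReducedWord {n : ℕ} (w : List (Fin n)) (σ : SignedPerm n) : Prop :=
  (w.map (gen n)).prod = σ ∧ ∀ w' : List (Fin n), (w'.map (gen n)).prod = σ → w.length ≤ w'.length

/-- `l₁(σ)`: the number of letters `π₀` in a reduced word of `σ`. (It is the same for all reduced
words, so that the infimum is only a way to name it.) -/
def l1 {n : ℕ} (σ : SignedPerm n) : ℕ :=
  sInf {c | ∃ w : List (Fin n), IsReducedWord w σ ∧ w.countP (fun i => i.val = 0) = c}

/-- `l₂(σ)`: the number of letters `π₁, …, π_{n-1}` in a reduced word of `σ`. -/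
def l2 {n : ℕ} (σ : SignedPerm n) : ℕ :=
  sInf {c | ∃ w : List (Fin n), IsReducedWord w σ ∧ w.countP (fun i => i.val ≠ 0) = c}

/-! ### Tensor powers -/

variable {H : Type*} [NormedAddCommGroup H] [InnerProductSpace ℂ H]

/-- The linear functional `y₁ ⊗ ⋯ ⊗ yₙ ↦ ∏ ⟨vᵢ, yᵢ⟩` on `H^{⊗n}`. -/
def form0Functional {n : ℕ} (v : Fin n → H) : (⨂[ℂ]^n H) →ₗ[ℂ] ℂ :=
  PiTensorProduct.lift
    ((MultilinearMap.mkPiAlgebra ℂ (Fin n) ℂ).compLinearMap (fun i => innerₛₗ ℂ (v i)))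

lemma form0Functional_tprod {n : ℕ} (v w : Fin n → H) :
    form0Functional v (PiTensorProduct.tprod ℂ w) = ∏ i, inner ℂ (v i) (w i) := by
  simp [form0Functional]

lemma form0Functional_update_add {n : ℕ} [DecidableEq (Fin n)] (v : Fin n → H) (i : Fin n)
    (a b : H) : form0Functional (Function.update v i (a + b)) =
      form0Functional (Function.update v i a) + form0Functional (Function.update v i b) := by
  ext w
  simp only [LinearMap.compMultilinearMap_apply, LinearMap.add_apply, form0Functional_tprod]
  simp only [← Finset.mul_prod_erase Finset.univ _ (Finset.mem_univ i), Function.update_self,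
    inner_add_left]
  have h : ∀ c : H, ∏ x ∈ Finset.univ.erase i, inner ℂ (Function.update v i c x) (w x) =
      ∏ x ∈ Finset.univ.erase i, inner ℂ (v x) (w x) := fun c =>
    Finset.prod_congr rfl fun x hx => by rw [Function.update_of_ne (Finset.ne_of_mem_erase hx)]
  rw [h, h, h, add_mul]

lemma form0Functional_update_smul {n : ℕ} [DecidableEq (Fin n)] (v : Fin n → H) (i : Fin n)
    (r : ℂ) (a : H) : form0Functional (Function.update v i (r • a)) =
      (starRingEnd ℂ) r • form0Functional (Function.update v i a) := by
  ext w
  simp only [LinearMap.compMultilinearMap_apply, LinearMap.smul_apply, form0Functional_tprod]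
  simp only [← Finset.mul_prod_erase Finset.univ _ (Finset.mem_univ i), Function.update_self,
    inner_smul_left]
  have h : ∀ c : H, ∏ x ∈ Finset.univ.erase i, inner ℂ (Function.update v i c x) (w x) =
      ∏ x ∈ Finset.univ.erase i, inner ℂ (v x) (w x) := fun c =>
    Finset.prod_congr rfl fun x hx => by rw [Function.update_of_ne (Finset.ne_of_mem_erase hx)]
  rw [h, h, smul_eq_mul, mul_assoc]

/-- Additive version of `form0`. -/
def form0Aux (H : Type*) [NormedAddCommGroup H] [InnerProductSpace ℂ H] (n : ℕ) :
    (⨂[ℂ]^n H) →+ ((⨂[ℂ]^n H) →ₗ[ℂ] ℂ) :=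
  PiTensorProduct.liftAddHom
    (fun p : ℂ × (Fin n → H) => (starRingEnd ℂ) p.1 • form0Functional p.2)
    (fun r f i hf => by
      have h := form0Functional_update_smul f i 0 0
      rw [smul_zero, map_zero, zero_smul, ← hf, Function.update_eq_self] at h
      simp only [h, smul_zero])
    (fun f => by simp)
    (fun r f i a b => by simp only [form0Functional_update_add, smul_add])
    (fun r r' f => by simp only [map_add, add_smul])
    (fun r f i r' => by
      simp only [form0Functional_update_smul, Function.update_eq_self, smul_smul, map_mul]
      rw [mul_comm])

lemma form0Aux_tprodCoeff {n : ℕ} (r : ℂ) (v : Fin n → H) :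
    form0Aux H n (PiTensorProduct.tprodCoeff ℂ r v) =
      (starRingEnd ℂ) r • form0Functional v := rfl

/-- The sesquilinear form `⟨·,·⟩_{0,0}` on `H^{⊗n}` (antilinear on the left, linear on the
right), determined by `⟨x₁ ⊗ ⋯ ⊗ xₙ, y₁ ⊗ ⋯ ⊗ yₙ⟩ = ∏ ⟨xᵢ, yᵢ⟩` (see `form0_tprod`). -/
def form0 (H : Type*) [NormedAddCommGroup H] [InnerProductSpace ℂ H] (n : ℕ) :
    (⨂[ℂ]^n H) →ₗ⋆[ℂ] (⨂[ℂ]^n H) →ₗ[ℂ] ℂ where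
  toFun := form0Aux H n
  map_add' := map_add _
  map_smul' r f := by
    refine PiTensorProduct.induction_on' f (fun {z v} => ?_) fun {a b} ha hb => ?_
    · rw [PiTensorProduct.smul_tprodCoeff', form0Aux_tprodCoeff, form0Aux_tprodCoeff, smul_smul,
        smul_eq_mul, map_mul]
    · rw [smul_add, map_add, map_add, ha, hb, smul_add]

lemma form0_tprod {n : ℕ} (v w : Fin n → H) :
    form0 H n (PiTensorProduct.tprod ℂ v) (PiTensorProduct.tprod ℂ w) =
      ∏ i, inner ℂ (v i) (w i) := by
  change form0Aux H n (PiTensorProduct.tprodCoeff ℂ 1 v) _ = _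
  rw [form0Aux_tprodCoeff, map_one, one_smul, form0Functional_tprod]

/-- The action of `Σ(n)` on `H^{⊗n}`, for the involution `J x = x̄`: the tensor
`σ(x₁ ⊗ ⋯ ⊗ xₙ)` has at the place `|σ(i)|` the vector `xᵢ` if `σ(i) > 0`, and `x̄ᵢ` if `σ(i) < 0`.
For `π₀` and `πᵢ` this is `x̄₁ ⊗ x₂ ⊗ ⋯ ⊗ xₙ` and the exchange of `xᵢ` and `xᵢ₊₁`. -/
def act (J : H →L[ℂ] H) {n : ℕ} (σ : SignedPerm n) : Module.End ℂ (⨂[ℂ]^n H) :=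
  (PiTensorProduct.reindex ℂ (fun _ : Fin n => H) (absPerm σ)).toLinearMap ∘ₗ
    PiTensorProduct.map
      (fun i : Fin n => if (σ.1 (i, 1)).2 = 1 then LinearMap.id else (J : H →ₗ[ℂ] H))

open Classical in
/-- The type-B symmetrization operator
`P^{(n)}_{α,q} = ∑_{σ ∈ Σ(n)} α^{l₁(σ)} q^{l₂(σ)} σ` on `H^{⊗n}`; for `n = 0` it is the
identity. -/
def symmetrizer (α q : ℝ) (J : H →L[ℂ] H) (n : ℕ) : Module.End ℂ (⨂[ℂ]^n H) :=
  ∑ σ : SignedPerm n, ((α : ℂ) ^ l1 σ * (q : ℂ) ^ l2 σ) • act J σ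

/-- `x₁ ⊗ ⋯ ⊗ xₙ₊₁ ↦ ⟨x, x_k⟩ x₁ ⊗ ⋯ ⊗ x̌_k ⊗ ⋯ ⊗ xₙ₊₁` for the functional `φ = ⟨x, ·⟩`. -/
def contract {n : ℕ} (φ : H →ₗ[ℂ] ℂ) (k : Fin (n + 1)) : (⨂[ℂ]^(n + 1) H) →ₗ[ℂ] (⨂[ℂ]^n H) :=
  PiTensorProduct.lift
    (LinearMap.uncurryMid k (φ.smulRight (PiTensorProduct.tprod ℂ (s := fun _ : Fin n => H))))

lemma contract_tprod {n : ℕ} (φ : H →ₗ[ℂ] ℂ) (k : Fin (n + 1)) (v : Fin (n + 1) → H) :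
    contract φ k (PiTensorProduct.tprod ℂ v) =
      φ (v k) • PiTensorProduct.tprod ℂ (fun i => v (k.succAbove i)) := by
  simp [contract]
  rfl

/-- `x₁ ⊗ ⋯ ⊗ xₙ ↦ x₁ ⊗ ⋯ ⊗ xₙ ⊗ x`. -/
def appendRight (x : H) (n : ℕ) : (⨂[ℂ]^n H) →ₗ[ℂ] (⨂[ℂ]^(n + 1) H) :=
  PiTensorProduct.lift (MultilinearMap.curryMid (Fin.last n)
    (PiTensorProduct.tprod ℂ (s := fun _ : Fin (n + 1) => H)) x)

lemma appendRight_tprod (x : H) (n : ℕ) (v : Fin n → H) :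
    appendRight x n (PiTensorProduct.tprod ℂ v) =
      PiTensorProduct.tprod ℂ (Fin.snoc (α := fun _ => H) v x) := by
  simp [appendRight]

/-! ### The Fock space of type B and its operators -/

/-- The algebraic full Fock space `⨁ₙ H^{⊗n}`. -/
abbrev Fock (H : Type*) [NormedAddCommGroup H] [InnerProductSpace ℂ H] : Type _ :=
  DirectSum ℕ (fun n => ⨂[ℂ]^n H)

/-- The inclusion of `H^{⊗n}` into the Fock space. -/
abbrev incl (n : ℕ) : (⨂[ℂ]^n H) →ₗ[ℂ] Fock H :=
  DirectSum.lof ℂ ℕ (fun n => ⨂[ℂ]^n H) n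

/-- The vacuum vector `Ω`. -/
def vacuum : Fock H := incl 0 (PiTensorProduct.tprod ℂ Fin.elim0)

open Classical in
/-- The form `⟨f, g⟩_{α,q} = ∑ₙ ⟨fₙ, P^{(n)}_{α,q} gₙ⟩_{0,0}` on the Fock space. -/
def fockInner (α q : ℝ) (J : H →L[ℂ] H) (f g : Fock H) : ℂ :=
  ∑ n ∈ DFinsupp.support f, form0 H n (f n) (symmetrizer α q J n (g n))

/-- The annihilation operator on `H^{⊗(m+1)}`; with `n = m + 1` and `k = j + 1` it is
`r_q(x) + α ℓ^N_q(x)`, where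
`r_q(x)(x₁ ⊗ ⋯ ⊗ xₙ) = ∑ₖ q^{n-k} ⟨x, xₖ⟩ x₁ ⊗ ⋯ ⊗ x̌ₖ ⊗ ⋯ ⊗ xₙ` and
`ℓ^N_q(x)(x₁ ⊗ ⋯ ⊗ xₙ) = q^{n-1} ∑ₖ q^{k-1} ⟨x, x̄ₖ⟩ x₁ ⊗ ⋯ ⊗ x̌ₖ ⊗ ⋯ ⊗ xₙ`. -/
def annihilateLevel (α q : ℝ) (J : H →L[ℂ] H) (x : H) (m : ℕ) :
    (⨂[ℂ]^(m + 1) H) →ₗ[ℂ] (⨂[ℂ]^m H) :=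
  (∑ j : Fin (m + 1), (q : ℂ) ^ (m - j.val) • contract (innerₛₗ ℂ x) j) +
    (α : ℂ) • (q : ℂ) ^ m •
      ∑ j : Fin (m + 1), (q : ℂ) ^ j.val • contract (innerₛₗ ℂ x ∘ₗ (J : H →ₗ[ℂ] H)) j

/-- The annihilation operator of type B, `b_{α,q}(x)`, with `b_{α,q}(x) Ω = 0`. -/
def annihilation (α q : ℝ) (J : H →L[ℂ] H) (x : H) : Module.End ℂ (Fock H) :=
  DirectSum.toModule ℂ ℕ (Fock H) (fun n => match n with
    | 0 => 0
    | m + 1 => incl m ∘ₗ annihilateLevel α q J x m)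

/-- The creation operator of type B, `b*_{α,q}(x)`:
`x₁ ⊗ ⋯ ⊗ xₙ ↦ x₁ ⊗ ⋯ ⊗ xₙ ⊗ x` and `Ω ↦ x`. -/
def creation (x : H) : Module.End ℂ (Fock H) :=
  DirectSum.toModule ℂ ℕ (Fock H) (fun n => incl (n + 1) ∘ₗ appendRight x n)

/-- `S` is adjoint to `R` with respect to `⟨·,·⟩_{α,q}`. -/
def IsAdjointFor (α q : ℝ) (J : H →L[ℂ] H) (S R : Module.End ℂ (Fock H)) : Prop :=
  ∀ f g : Fock H, fockInner α q J (S f) g = fockInner α q J f (R g)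

/-- The operator by which the generator `πᵢ` (`i < n`) acts on `H^{⊗n}`. -/
def piOp (J : H →L[ℂ] H) (n i : ℕ) : Module.End ℂ (⨂[ℂ]^n H) :=
  if h : i < n then act J (gen n ⟨i, h⟩) else 1

/-- `R^{(n)}_{α,q} = 1 + ∑_{k=1}^{n-1} q^k π_{n-1} ⋯ π_{n-k}
  + α q^{n-1} π_{n-1} π_{n-2} ⋯ π₁ π₀ (1 + ∑_{k=1}^{n-1} q^k π₁ ⋯ π_k)`, for `n ≥ 1`. -/
def opR (α q : ℝ) (J : H →L[ℂ] H) (n : ℕ) : Module.End ℂ (⨂[ℂ]^n H) :=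
  (1 + ∑ k ∈ Finset.Icc 1 (n - 1), (q : ℂ) ^ k •
      ((List.range k).map (fun j => piOp J n (n - 1 - j))).prod) +
    ((α : ℂ) * (q : ℂ) ^ (n - 1)) •
      (((List.range n).map (fun j => piOp J n (n - 1 - j))).prod *
        (1 + ∑ k ∈ Finset.Icc 1 (n - 1), (q : ℂ) ^ k •
          ((List.range k).map (fun j => piOp J n (j + 1))).prod))

/-- `p₀(T)(x₁ ⊗ ⋯ ⊗ x_{m+1}) = x₁ ⊗ ⋯ ⊗ x_m ⊗ T x_{m+1}`. -/
def gaugeZero (T : H →L[ℂ] H) (m : ℕ) : Module.End ℂ (⨂[ℂ]^(m + 1) H) :=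
  PiTensorProduct.map
    (fun i : Fin (m + 1) => if i = Fin.last m then (T : H →ₗ[ℂ] H) else LinearMap.id)

/-- The gauge operator `p(T)`: `p(T) Ω = 0`, and `p(T) = p₀(T) R^{(n)}_{α,q}` on `H^{⊗n}`,
`n ≥ 1`. -/
def gauge (α q : ℝ) (J : H →L[ℂ] H) (T : H →L[ℂ] H) : Module.End ℂ (Fock H) :=
  DirectSum.toModule ℂ ℕ (Fock H) (fun n => match n with
    | 0 => 0
    | m + 1 => incl (m + 1) ∘ₗ (gaugeZero T m * opR α q J (m + 1)))

/-- The operator of type B, `B_{α,q}(x) = b_{α,q}(x) + b*_{α,q}(x) + p(T)`. -/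
def opB (α q : ℝ) (J : H →L[ℂ] H) (T : H →L[ℂ] H) (x : H) : Module.End ℂ (Fock H) :=
  annihilation α q J x + creation x + gauge α q J T

/-- The vacuum state `φ(X) = ⟨Ω, X Ω⟩_{α,q}`. -/
def vacuumState (α q : ℝ) (J : H →L[ℂ] H) (X : Module.End ℂ (Fock H)) : ℂ :=
  fockInner α q J vacuum (X vacuum)

/-- `μ` is a probability distribution of `X` with respect to the vacuum state: a probability
measure on the line with finite moments and `φ(Xⁿ) = ∫ yⁿ dμ(y)` for all `n`. -/
def IsVacuumDistribution (α q : ℝ) (J : H →L[ℂ] H) (X : Module.End ℂ (Fock H))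
    (μ : MeasureTheory.Measure ℝ) : Prop :=
  MeasureTheory.IsProbabilityMeasure μ ∧
    (∀ n : ℕ, MeasureTheory.Integrable (fun y : ℝ => y ^ n) μ) ∧
    ∀ n : ℕ, vacuumState α q J (X ^ n) = ((∫ y, y ^ n ∂μ : ℝ) : ℂ)

/-! ### The Poisson polynomials of type B -/

/-- `[n]_q = 1 + q + ⋯ + q^{n-1}`. -/
def qNat (q : ℝ) (n : ℕ) : ℝ := ∑ i ∈ Finset.range n, q ^ i

/-- The `(α,q)`-Poisson polynomials of type B: `P₀ = 1`, `P₁ = y` and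
`y Pₙ = Pₙ₊₁ + [n]_q (1 + α q^{n-1}) Pₙ + [n]_q (1 + α q^{n-1}) Pₙ₋₁` for `n ≥ 1`. -/
def poissonPoly (α q : ℝ) : ℕ → Polynomial ℝ
  | 0 => 1
  | 1 => Polynomial.X
  | n + 2 =>
    (Polynomial.X - Polynomial.C (qNat q (n + 1) * (1 + α * q ^ n))) * poissonPoly α q (n + 1) -
      Polynomial.C (qNat q (n + 1) * (1 + α * q ^ n)) * poissonPoly α q n

/-- `μ` is an orthogonality measure of the `(α,q)`-Poisson polynomials of type B: a probability
measure with finite moments with respect to which these polynomials are pairwise orthogonal. -/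
def IsPoissonMeasure (α q : ℝ) (μ : MeasureTheory.Measure ℝ) : Prop :=
  MeasureTheory.IsProbabilityMeasure μ ∧
    (∀ n : ℕ, MeasureTheory.Integrable (fun y : ℝ => y ^ n) μ) ∧
    ∀ m n : ℕ, m ≠ n → ∫ y, (poissonPoly α q m).eval y * (poissonPoly α q n).eval y ∂μ = 0

end TypeB

end

noncomputable section

namespace TypeB

/-! ### Lengths of signed permutations -/

/-! Adjointness is a statement about `Σ(n+1)`. The lengths are explicit statistics of the word
`σ(1), …, σ(n)`: `l1` counts the negative entries and `l2` counts inequalities over pairs of places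
(`l1_eq_negCount`, `l2_eq_invCount`). Each element of `Σ(n+1)` arises once by inserting `±(n+1)` at
a place of a word in `Σ(n)`. With the place `k` counted from `0`, this multiplies the weight by
`q^(n-k)` for the sign `+` and by `α q^(n+k)` for the sign `-`. In the pairing with `v ⊗ x` the
inserted letter produces `⟨x, w_k⟩` or `⟨x, J w_k⟩`, so the sum over insertions is exactly the
annihilation operator (`form0_appendRight_tprod`).

For the distribution let `J x = s x`. On `x ⊗ ⋯ ⊗ x` (`n` factors) annihilation and gauge both have
the coefficient `[n]_q (1 + sα q^(n-1))`, so the operator follows the recurrence of the polynomials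
with parameter `sα`, and `P_n` of the operator sends `Ω` to `x ⊗ ⋯ ⊗ x` (`aeval_opB_vacuum`). Hence
the vacuum state of `P_n` is `1` for `n = 0` and `0` otherwise. As the `P_n` span all polynomials,
vacuum distributions are the probability measures with finite moments for which `∫ P_n = 0` for `n ≥
1`; by Favard's argument (`apply_poissonPoly_mul_of_lt`) these are the orthogonality measures.

Existence and uniqueness of such a measure rest on the Jacobi coefficients being nonnegative and
bounded. Spectral decompositions of truncated Jacobi matrices give quadrature formulas on one
compact interval, and a weak limit is an orthogonality measure. Any competitor has the same moments,
which confine it to the same interval, and there Weierstrass approximation applies. -/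

/-- The sign of `σ(k)` for `k > 0`. -/
def signs {n : ℕ} (σ : SignedPerm n) (k : Fin n) : ℤˣ := (σ.1 (k, 1)).2

lemma signedPerm_apply {n : ℕ} (σ : SignedPerm n) (k : Fin n) (s : ℤˣ) :
    σ.1 (k, s) = (absPerm σ k, signs σ k * s) := by
  rcases Int.units_eq_one_or s with rfl | rfl
  · simp [absPerm, signs]
  · rw [signedPerm_neg]; simp [absPerm, signs]

lemma signedPerm_ext {n : ℕ} {σ τ : SignedPerm n} (h : ∀ k, absPerm σ k = absPerm τ k)
    (h' : ∀ k, signs σ k = signs τ k) : σ = τ := by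
  apply Subtype.ext
  ext1 ⟨k, s⟩
  rw [signedPerm_apply, signedPerm_apply, h, h']

/-- The signed permutation with given absolute values and signs. -/
def ofAbsSigns {n : ℕ} (p : Equiv.Perm (Fin n)) (e : Fin n → ℤˣ) : SignedPerm n :=
  ⟨{ toFun := fun k => (p k.1, e k.1 * k.2)
     invFun := fun k => (p.symm k.1, e (p.symm k.1) * k.2)
     left_inv := fun k => by simp [← mul_assoc]
     right_inv := fun k => by simp [← mul_assoc] }, by
    rw [Subgroup.mem_centralizer_iff]
    rintro _ rfl
    ext1 ⟨k, s⟩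
    simp [negPerm]⟩

lemma absPerm_ofAbsSigns {n : ℕ} (p : Equiv.Perm (Fin n)) (e : Fin n → ℤˣ) (k : Fin n) :
    absPerm (ofAbsSigns p e) k = p k := rfl

lemma signs_ofAbsSigns {n : ℕ} (p : Equiv.Perm (Fin n)) (e : Fin n → ℤˣ) (k : Fin n) :
    signs (ofAbsSigns p e) k = e k := by
  change e k * 1 = e k
  rw [mul_one]

/-- A signed permutation is given by its absolute values and its signs. -/
def signedPermEquiv (n : ℕ) : SignedPerm n ≃ Equiv.Perm (Fin n) × (Fin n → ℤˣ) where
  toFun σ := (absPerm σ, signs σ)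
  invFun a := ofAbsSigns a.1 a.2
  left_inv _ := signedPerm_ext (fun k => absPerm_ofAbsSigns _ _ k) (fun k => signs_ofAbsSigns _ _ k)
  right_inv a := Prod.ext (Equiv.ext fun k => absPerm_ofAbsSigns _ _ k)
    (funext fun k => signs_ofAbsSigns a.1 a.2 k)

lemma absPerm_mul {n : ℕ} (σ τ : SignedPerm n) (k : Fin n) :
    absPerm (σ * τ) k = absPerm σ (absPerm τ k) := by
  change (σ.1 (τ.1 (k, 1))).1 = _
  rw [signedPerm_apply τ, signedPerm_apply σ]

lemma signs_mul {n : ℕ} (σ τ : SignedPerm n) (k : Fin n) :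
    signs (σ * τ) k = signs σ (absPerm τ k) * signs τ k := by
  change (σ.1 (τ.1 (k, 1))).2 = _
  rw [signedPerm_apply τ, signedPerm_apply σ, mul_one]

lemma absPerm_one {n : ℕ} (k : Fin n) : absPerm (1 : SignedPerm n) k = k := rfl

lemma signs_one {n : ℕ} (k : Fin n) : signs (1 : SignedPerm n) k = 1 := rfl

lemma absPerm_gen_zero {n : ℕ} {i : Fin n} (hi : i.val = 0) (k : Fin n) :
    absPerm (gen n i) k = k := by
  change (genPerm n i (k, 1)).1 = k
  rw [genPerm, if_pos hi]
  by_cases hk : k = i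
  · subst hk; simp
  · rw [Equiv.swap_apply_of_ne_of_ne (by simp [hk]) (by simp [hk])]

lemma signs_gen_zero {n : ℕ} {i : Fin n} (hi : i.val = 0) (k : Fin n) :
    signs (gen n i) k = if k = i then -1 else 1 := by
  change (genPerm n i (k, 1)).2 = _
  rw [genPerm, if_pos hi]
  by_cases hk : k = i
  · subst hk; simp
  · rw [Equiv.swap_apply_of_ne_of_ne (by simp [hk]) (by simp [hk]), if_neg hk]

lemma absPerm_gen {n : ℕ} {i : Fin n} (hi : i.val ≠ 0) (k : Fin n) :
    absPerm (gen n i) k = Equiv.swap ⟨i.val - 1, by omega⟩ i k := by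
  change (genPerm n i (k, 1)).1 = _
  rw [genPerm, if_neg hi]
  rfl

lemma signs_gen {n : ℕ} {i : Fin n} (hi : i.val ≠ 0) (k : Fin n) : signs (gen n i) k = 1 := by
  change (genPerm n i (k, 1)).2 = _
  rw [genPerm, if_neg hi]
  rfl

/-- The number of `k > 0` with `σ(k) < 0`. -/
def negCount {n : ℕ} (σ : SignedPerm n) : ℕ := ∑ i, if signs σ i = -1 then 1 else 0

/-- The number of the inequalities `a > b`, `-a > b` which hold if `|a| = i`, `|b| = j ≠ i` and
`b` has the sign `s`. -/
def pairWeight {n : ℕ} (i j : Fin n) (s : ℤˣ) : ℕ :=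
  if i < j then (if s = -1 then 2 else 0) else 1

/-- The number of pairs `i < j` with `σ(i) > σ(j)` plus the number of those with
`-σ(i) > σ(j)`. -/
def invCount {n : ℕ} (σ : SignedPerm n) : ℕ :=
  ∑ i, ∑ j, if i < j then pairWeight (absPerm σ i) (absPerm σ j) (signs σ j) else 0

/-- Exchanging two neighbouring places permutes the ordered pairs `i < j`, except that `(a, b)` is
traded for `(b, a)`. The additive form avoids subtraction in `ℕ`. -/
lemma sum_pairs_swap {n : ℕ} {a b : Fin n} (hab : a.val + 1 = b.val) (W : Fin n → Fin n → ℕ) :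
    (∑ i, ∑ j, if i < j then W (Equiv.swap a b i) (Equiv.swap a b j) else 0) + W a b =
      (∑ i, ∑ j, if i < j then W i j else 0) + W b a := by
  have h1 : (∑ i, ∑ j, if i < j then W (Equiv.swap a b i) (Equiv.swap a b j) else 0) =
      ∑ i, ∑ j, if Equiv.swap a b i < Equiv.swap a b j then W i j else 0 := by
    rw [← Equiv.sum_comp (Equiv.swap a b)]
    refine Finset.sum_congr rfl fun i _ => ?_
    rw [← Equiv.sum_comp (Equiv.swap a b)]
    simp
  have h2 : ∀ c d : Fin n, W c d = ∑ i, ∑ j, if i = c ∧ j = d then W i j else 0 := fun c d => by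
    simp [ite_and]
  have h3 : a ≠ b := fun h => by rw [h] at hab; omega
  rw [h1, h2 a b, h2 b a]
  simp only [← Finset.sum_add_distrib]
  refine Finset.sum_congr rfl fun i _ => Finset.sum_congr rfl fun j _ => ?_
  by_cases h4 : i = a ∧ j = b
  · obtain ⟨rfl, rfl⟩ := h4
    have h5 : i < j := Fin.lt_def.2 (by omega)
    simp [h3, h5, not_lt_of_gt h5]
  by_cases h5 : i = b ∧ j = a
  · obtain ⟨rfl, rfl⟩ := h5
    have h6 : j < i := Fin.lt_def.2 (by omega)
    simp [h3.symm, h6, not_lt_of_gt h6]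
  rw [if_neg h4, if_neg h5]
  refine congrArg (· + 0) (if_congr ?_ rfl rfl)
  -- For the remaining pairs, the swap of two neighbours preserves strict order.
  simp only [Equiv.swap_apply_def, Fin.lt_def, Fin.ext_iff] at *
  split_ifs <;> omega

lemma negCount_mul_gen_zero {n : ℕ} (σ : SignedPerm n) {i : Fin n} (hi : i.val = 0) :
    negCount (σ * gen n i) + (if signs σ i = -1 then 1 else 0) =
      negCount σ + (if signs σ i = -1 then 0 else 1) := by
  unfold negCount
  rw [← Finset.add_sum_erase _ _ (Finset.mem_univ i),
    ← Finset.add_sum_erase (a := i) _ (fun j => if signs σ j = -1 then 1 else 0) (Finset.mem_univ i)]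
  have h : ∀ j ∈ Finset.univ.erase i, (if signs (σ * gen n i) j = -1 then 1 else 0) =
      if signs σ j = -1 then 1 else 0 := fun j hj => by
    rw [signs_mul, absPerm_gen_zero hi, signs_gen_zero hi, if_neg (Finset.ne_of_mem_erase hj),
      mul_one]
  rw [Finset.sum_congr rfl h, signs_mul, absPerm_gen_zero hi, signs_gen_zero hi, if_pos rfl]
  rcases Int.units_eq_one_or (signs σ i) with h | h <;> simp [h] <;> omega

/-- A pair `a < b` reads only the sign at the later place `b`, which is never the first place, where
`π₀` acts. -/
lemma invCount_mul_gen_zero {n : ℕ} (σ : SignedPerm n) {i : Fin n} (hi : i.val = 0) :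
    invCount (σ * gen n i) = invCount σ := by
  unfold invCount
  refine Finset.sum_congr rfl fun a _ => Finset.sum_congr rfl fun b _ => ?_
  split_ifs with hab
  · have hb : b ≠ i := fun h => by rw [h, Fin.lt_def] at hab; omega
    rw [signs_mul, absPerm_mul, absPerm_mul, absPerm_gen_zero hi, absPerm_gen_zero hi,
      signs_gen_zero hi, if_neg hb, mul_one]
  · rfl

lemma negCount_mul_gen {n : ℕ} (σ : SignedPerm n) {i : Fin n} (hi : i.val ≠ 0) :
    negCount (σ * gen n i) = negCount σ := by
  unfold negCount
  rw [← Equiv.sum_comp (absPerm (gen n i)) (fun j => if signs σ j = -1 then 1 else 0)]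
  simp only [signs_mul, signs_gen hi, mul_one]

lemma invCount_mul_gen {n : ℕ} (σ : SignedPerm n) {i j : Fin n} (hij : j.val + 1 = i.val) :
    invCount (σ * gen n i) + pairWeight (absPerm σ j) (absPerm σ i) (signs σ i) =
      invCount σ + pairWeight (absPerm σ i) (absPerm σ j) (signs σ j) := by
  have hi : i.val ≠ 0 := by omega
  have hj : (⟨i.val - 1, by omega⟩ : Fin n) = j := Fin.ext (by simp; omega)
  have h := sum_pairs_swap hij fun a b => pairWeight (absPerm σ a) (absPerm σ b) (signs σ b)
  rw [← hj] at h ⊢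
  unfold invCount
  simp only [signs_mul, absPerm_mul, signs_gen hi, absPerm_gen hi, mul_one]
  exact h

/-- A letter `π₀` changes `negCount` by exactly one and leaves `invCount` alone; for the other
letters it is the reverse. Both statistics vanish at the identity. -/
lemma count_le_of_word {n : ℕ} (w : List (Fin n)) :
    negCount (w.map (gen n)).prod ≤ w.countP (fun i => i.val = 0) ∧
      invCount (w.map (gen n)).prod ≤ w.countP (fun i => i.val ≠ 0) := by
  induction w using List.reverseRecOn with
  | nil => simp [negCount, invCount, signs_one, absPerm_one, pairWeight]
  | append_singleton w i ih =>
    simp only [List.map_append, List.prod_append, List.countP_append, List.map_cons, List.map_nil,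
      List.prod_cons, List.prod_nil, mul_one, List.countP_cons, List.countP_nil]
    set σ := (w.map (gen n)).prod
    by_cases hi : i.val = 0
    · have h := negCount_mul_gen_zero σ hi
      rw [invCount_mul_gen_zero σ hi]
      split_ifs at h <;> simp [hi] at * <;> omega
    · have h := invCount_mul_gen σ (i := i) (j := ⟨i.val - 1, by omega⟩) (by simp; omega)
      rw [negCount_mul_gen σ hi]
      -- Since the absolute values differ, one of the two weights in `h` is `1` and the other is `0`
      -- or `2`.
      have h1 : absPerm σ i ≠ absPerm σ ⟨i.val - 1, by omega⟩ := fun h => by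
        have := congrArg Fin.val ((absPerm σ).injective h)
        simp at this; omega
      unfold pairWeight at h
      split_ifs at h <;> simp [hi] at * <;> omega

/-- If no generator lowers its statistic, then `0 < σ(1) < σ(2) < ⋯`, and the only such `σ` is the
identity. -/
lemma exists_descent {n : ℕ} {σ : SignedPerm n} (hσ : σ ≠ 1) :
    ∃ i : Fin n, (i.val = 0 ∧ negCount (σ * gen n i) + 1 = negCount σ) ∨
      (i.val ≠ 0 ∧ invCount (σ * gen n i) + 1 = invCount σ) := by
  by_contra! hcon
  have h0 : ∀ i : Fin n, i.val = 0 → signs σ i = 1 := fun i hi => by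
    have h1 := (hcon i).1 hi
    have h2 := negCount_mul_gen_zero σ hi
    rcases Int.units_eq_one_or (signs σ i) with h | h
    · exact h
    · simp [h] at h2; omega
  -- With `σ(j) > 0`, either a negative `σ(i)` or `|σ(i)| < |σ(j)|` would make the generator at `i`
  -- a descent.
  have hstep : ∀ i j : Fin n, j.val + 1 = i.val → signs σ j = 1 →
      signs σ i = 1 ∧ absPerm σ j < absPerm σ i := fun i j hij hj => by
    have h1 := (hcon i).2 (by omega)
    have h2 := invCount_mul_gen σ hij
    have h3 : absPerm σ i ≠ absPerm σ j := fun h => by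
      have := (absPerm σ).injective h
      rw [this] at hij; omega
    have h4 := lt_or_gt_of_ne h3
    rcases Int.units_eq_one_or (signs σ i) with h | h <;> rcases h4 with h4 | h4 <;>
      simp [pairWeight, h, hj, h4, not_lt_of_gt h4] at h2 ⊢ <;> omega
  have hs : ∀ (m : ℕ) (hm : m < n), signs σ ⟨m, hm⟩ = 1 := fun m => by
    induction m with
    | zero => exact fun hm => h0 _ rfl
    | succ m ih => exact fun hm => (hstep ⟨m + 1, hm⟩ ⟨m, by omega⟩ rfl (ih _)).1
  have hmono : StrictMono (absPerm σ) := by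
    have : ∀ (d m : ℕ) (hm : m + 1 + d < n),
        absPerm σ ⟨m, by omega⟩ < absPerm σ ⟨m + 1 + d, hm⟩ := by
      intro d
      induction d with
      | zero => exact fun m hm => (hstep ⟨m + 1, hm⟩ ⟨m, by omega⟩ rfl (hs _ _)).2
      | succ d ih =>
        intro m hm
        exact (ih m (by omega)).trans
          (hstep ⟨m + 1 + (d + 1), hm⟩ ⟨m + 1 + d, by omega⟩ rfl (hs _ _)).2
    intro a b hab
    have h := this (b.val - a.val - 1) a.val (by have := Fin.lt_def.1 hab; omega)
    have h' : (⟨a.val + 1 + (b.val - a.val - 1), by omega⟩ : Fin n) = b :=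
      Fin.ext (by have := Fin.lt_def.1 hab; simp only; omega)
    rwa [h'] at h
  refine hσ (signedPerm_ext (fun k => ?_) fun k => hs k.val k.isLt)
  -- `Fin n` has only one order automorphism.
  have := Subsingleton.elim (StrictMono.orderIsoOfSurjective _ hmono (absPerm σ).surjective)
    (OrderIso.refl (Fin n))
  exact congrArg (fun e : Fin n ≃o Fin n => e k) this

/-! ### Reduced words and their letter counts. -/

lemma gen_mul_gen {n : ℕ} (i : Fin n) : gen n i * gen n i = 1 := by
  by_cases hi : i.val = 0
  · refine signedPerm_ext (fun k => ?_) fun k => ?_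
    · rw [absPerm_mul, absPerm_gen_zero hi, absPerm_gen_zero hi, absPerm_one]
    · rw [signs_mul, absPerm_gen_zero hi, signs_gen_zero hi, signs_one]
      split_ifs <;> rfl
  · refine signedPerm_ext (fun k => ?_) fun k => ?_
    · rw [absPerm_mul, absPerm_gen hi, absPerm_gen hi, absPerm_one, Equiv.swap_apply_self]
    · rw [signs_mul, signs_gen hi, signs_gen hi, signs_one, one_mul]

/-- Sorting: descents are stripped off until the identity remains; since the generators are
involutions, the stripped letters spell `σ`. -/
lemma exists_word {n : ℕ} (σ : SignedPerm n) :
    ∃ w : List (Fin n), (w.map (gen n)).prod = σ ∧ w.length = negCount σ + invCount σ := by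
  induction h : negCount σ + invCount σ using Nat.strong_induction_on generalizing σ with
  | _ m ih =>
    by_cases hσ : σ = 1
    · subst hσ
      have := count_le_of_word ([] : List (Fin n))
      simp at this
      exact ⟨[], rfl, by simp; omega⟩
    · obtain ⟨i, hi⟩ := exists_descent hσ
      have hlt : negCount (σ * gen n i) + invCount (σ * gen n i) + 1 = m := by
        rcases hi with ⟨hi, h'⟩ | ⟨hi, h'⟩
        · rw [invCount_mul_gen_zero σ hi]; omega
        · rw [negCount_mul_gen σ hi]; omega
      obtain ⟨w, hw, hl⟩ := ih _ (by omega) (σ * gen n i) rfl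
      refine ⟨w ++ [i], ?_, by simp [hl]; omega⟩
      simp [hw, mul_assoc, gen_mul_gen]

/-- Each letter count is bounded below by its statistic, while minimality bounds their sum above by
the sum of the statistics, so both bounds are equalities. In particular the counts do not depend on
the reduced word. -/
lemma isReducedWord_counts {n : ℕ} {w : List (Fin n)} {σ : SignedPerm n}
    (hw : IsReducedWord w σ) : w.countP (fun i => i.val = 0) = negCount σ ∧
      w.countP (fun i => i.val ≠ 0) = invCount σ := by
  obtain ⟨w', hw', hl⟩ := exists_word σ
  have h1 := hw.2 w' hw'
  have h2 := count_le_of_word w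
  rw [hw.1] at h2
  have h3 := List.length_eq_countP_add_countP (fun i : Fin n => decide (i.val = 0)) (l := w)
  have h4 : w.countP (fun i => i.val ≠ 0) =
      w.countP (fun a => decide ¬ decide (a.val = 0) = true) := by congr 1; ext; simp
  omega

lemma exists_isReducedWord {n : ℕ} (σ : SignedPerm n) : ∃ w, IsReducedWord w σ := by
  obtain ⟨w, hw, hl⟩ := exists_word σ
  refine ⟨w, hw, fun w' hw' => ?_⟩
  have h2 := count_le_of_word w'
  rw [hw'] at h2
  have h3 := List.length_eq_countP_add_countP (fun i : Fin n => decide (i.val = 0)) (l := w')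
  have h4 : w'.countP (fun i => i.val ≠ 0) =
      w'.countP (fun a => decide ¬ decide (a.val = 0) = true) := by congr 1; ext; simp
  omega

lemma l1_eq_negCount {n : ℕ} (σ : SignedPerm n) : l1 σ = negCount σ := by
  have : {c | ∃ w : List (Fin n), IsReducedWord w σ ∧ w.countP (fun i => i.val = 0) = c} =
      {negCount σ} := by
    ext c
    constructor
    · rintro ⟨w, hw, rfl⟩
      exact (isReducedWord_counts hw).1
    · rintro rfl
      obtain ⟨w, hw⟩ := exists_isReducedWord σ
      exact ⟨w, hw, (isReducedWord_counts hw).1⟩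
  rw [l1, this, csInf_singleton]

lemma l2_eq_invCount {n : ℕ} (σ : SignedPerm n) : l2 σ = invCount σ := by
  have : {c | ∃ w : List (Fin n), IsReducedWord w σ ∧ w.countP (fun i => i.val ≠ 0) = c} =
      {invCount σ} := by
    ext c
    constructor
    · rintro ⟨w, hw, rfl⟩
      exact (isReducedWord_counts hw).2
    · rintro rfl
      obtain ⟨w, hw⟩ := exists_isReducedWord σ
      exact ⟨w, hw, (isReducedWord_counts hw).2⟩
  rw [l2, this, csInf_singleton]

/-! ### Inserting a largest letter -/

/-- The signed permutation obtained from the word `σ(1), …, σ(n)` by inserting the letter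
`±(n + 1)` at the place `k`. -/
def insertLast {n : ℕ} (k : Fin (n + 1)) (s : ℤˣ) (σ : SignedPerm n) : SignedPerm (n + 1) :=
  ofAbsSigns (((finSuccEquiv' k).trans (absPerm σ).optionCongr).trans
    (finSuccEquiv' (Fin.last n)).symm) (Fin.insertNth (α := fun _ => ℤˣ) k s (signs σ))

lemma absPerm_insertLast_self {n : ℕ} (k : Fin (n + 1)) (s : ℤˣ) (σ : SignedPerm n) :
    absPerm (insertLast k s σ) k = Fin.last n := by
  simp [insertLast, absPerm_ofAbsSigns]

lemma absPerm_insertLast_succAbove {n : ℕ} (k : Fin (n + 1)) (s : ℤˣ) (σ : SignedPerm n)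
    (i : Fin n) : absPerm (insertLast k s σ) (k.succAbove i) = (absPerm σ i).castSucc := by
  simp [insertLast, absPerm_ofAbsSigns]

lemma signs_insertLast_self {n : ℕ} (k : Fin (n + 1)) (s : ℤˣ) (σ : SignedPerm n) :
    signs (insertLast k s σ) k = s := by
  simp [insertLast, signs_ofAbsSigns]

lemma signs_insertLast_succAbove {n : ℕ} (k : Fin (n + 1)) (s : ℤˣ) (σ : SignedPerm n)
    (i : Fin n) : signs (insertLast k s σ) (k.succAbove i) = signs σ i := by
  simp [insertLast, signs_ofAbsSigns]

/-- Place, sign and remaining word can be read off, which gives injectivity; surjectivity follows by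
counting, `2^(n+1) (n+1)! = (n+1) · 2 · 2^n n!`. -/
lemma insertLast_bijective (n : ℕ) : Function.Bijective
    (fun a : Fin (n + 1) × ℤˣ × SignedPerm n => insertLast a.1 a.2.1 a.2.2) := by
  classical
  rw [Fintype.bijective_iff_injective_and_card]
  constructor
  · rintro ⟨k, s, σ⟩ ⟨k', s', σ'⟩ h
    simp only at h
    have hk : k = k' := by
      apply (absPerm (insertLast k s σ)).injective
      rw [absPerm_insertLast_self, h, absPerm_insertLast_self]
    subst hk
    have hs : s = s' := by
      rw [← signs_insertLast_self k s σ, h, signs_insertLast_self]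
    subst hs
    have hσ : σ = σ' := by
      refine signedPerm_ext (fun i => ?_) fun i => ?_
      · apply Fin.castSucc_injective
        rw [← absPerm_insertLast_succAbove k s, h, absPerm_insertLast_succAbove]
      · rw [← signs_insertLast_succAbove k s, h, signs_insertLast_succAbove]
    rw [hσ]
  · simp only [Fintype.card_prod, Fintype.card_congr (signedPermEquiv _), Fintype.card_perm,
      Fintype.card_fin, Fintype.card_units_int, Fintype.card_fun, Nat.factorial_succ, pow_succ]
    ring

lemma negCount_insertLast {n : ℕ} (k : Fin (n + 1)) (s : ℤˣ) (σ : SignedPerm n) :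
    negCount (insertLast k s σ) = negCount σ + if s = -1 then 1 else 0 := by
  unfold negCount
  rw [Fin.sum_univ_succAbove _ k, signs_insertLast_self, add_comm]
  simp only [signs_insertLast_succAbove]

lemma sum_lt_succAbove {n : ℕ} (k : Fin (n + 1)) :
    ∑ j : Fin n, (if k < k.succAbove j then 1 else 0) = n - k.val := by
  have h := Fin.sum_univ_succAbove (fun j => if k < j then 1 else 0) k
  rw [if_neg (lt_irrefl k), zero_add] at h
  rw [← h, Finset.sum_boole, Finset.filter_lt_eq_Ioi, Nat.cast_id, Fin.card_Ioi]
  omega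

lemma sum_succAbove_lt {n : ℕ} (k : Fin (n + 1)) :
    ∑ j : Fin n, (if k.succAbove j < k then 1 else 0) = k.val := by
  have h := Fin.sum_univ_succAbove (fun j => if j < k then 1 else 0) k
  rw [if_neg (lt_irrefl k), zero_add] at h
  rw [← h, Finset.sum_boole, Finset.filter_gt_eq_Iio, Nat.cast_id, Fin.card_Iio]

/-- The new letter is largest in absolute value. With each of the `n - k` later letters it forms a
pair of weight `1`; with each of the `k` earlier ones, a pair of weight `2` if it is negative and
`0` otherwise. Old pairs keep their weight. -/
lemma invCount_insertLast {n : ℕ} (k : Fin (n + 1)) (s : ℤˣ) (σ : SignedPerm n) :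
    invCount (insertLast k s σ) =
      invCount σ + ((n - k.val) + if s = -1 then 2 * k.val else 0) := by
  unfold invCount
  rw [Fin.sum_univ_succAbove _ k]
  simp only [Fin.sum_univ_succAbove _ k, absPerm_insertLast_self, absPerm_insertLast_succAbove,
    signs_insertLast_succAbove, signs_insertLast_self, lt_irrefl, if_false, zero_add,
    Finset.sum_add_distrib, Fin.succAbove_lt_succAbove_iff]
  have h1 : ∑ j : Fin n, (if k < k.succAbove j then
      pairWeight (Fin.last n) (absPerm σ j).castSucc (signs σ j) else 0) = n - k.val := by
    rw [← sum_lt_succAbove]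
    refine Finset.sum_congr rfl fun j _ => ?_
    rw [pairWeight, if_neg (not_lt_of_gt (Fin.castSucc_lt_last _))]
  have h2 : ∑ j : Fin n, (if k.succAbove j < k then
      pairWeight (absPerm σ j).castSucc (Fin.last n) s else 0) =
        if s = -1 then 2 * k.val else 0 := by
    simp only [pairWeight, if_pos (Fin.castSucc_lt_last _)]
    split_ifs
    · conv_rhs => rw [← sum_succAbove_lt k, Finset.mul_sum]
      simp
    · simp
  have h3 : ∀ i j : Fin n, pairWeight (absPerm σ i).castSucc (absPerm σ j).castSucc (signs σ j) =
      pairWeight (absPerm σ i) (absPerm σ j) (signs σ j) := fun i j => by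
    simp [pairWeight]
  simp only [h1, h2, h3]
  omega

/-! ### Creation and annihilation are adjoint -/

variable {H : Type*} [NormedAddCommGroup H] [InnerProductSpace ℂ H]

lemma act_tprod (J : H →L[ℂ] H) {n : ℕ} (σ : SignedPerm n) (w : Fin n → H) :
    act J σ (PiTensorProduct.tprod ℂ w) = PiTensorProduct.tprod ℂ (fun j =>
      if signs σ ((absPerm σ).symm j) = 1 then w ((absPerm σ).symm j)
      else J (w ((absPerm σ).symm j))) := by
  rw [act, LinearMap.comp_apply, PiTensorProduct.map_tprod, LinearEquiv.coe_coe,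
    PiTensorProduct.reindex_tprod]
  congr 1
  ext1 j
  change (if signs σ ((absPerm σ).symm j) = 1 then LinearMap.id else (J : H →ₗ[ℂ] H)) _ = _
  split_ifs <;> rfl

lemma form0_act_tprod (J : H →L[ℂ] H) {n : ℕ} (σ : SignedPerm n) (v w : Fin n → H) :
    form0 H n (PiTensorProduct.tprod ℂ v) (act J σ (PiTensorProduct.tprod ℂ w)) =
      ∏ i, inner ℂ (v (absPerm σ i)) (if signs σ i = 1 then w i else J (w i)) := by
  rw [act_tprod, form0_tprod, ← Equiv.prod_comp (absPerm σ)]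
  simp

open Classical in
lemma form0_symmetrizer_tprod (α q : ℝ) (J : H →L[ℂ] H) {n : ℕ} (v w : Fin n → H) :
    form0 H n (PiTensorProduct.tprod ℂ v)
      (symmetrizer α q J n (PiTensorProduct.tprod ℂ w)) =
      ∑ σ : SignedPerm n, ((α : ℂ) ^ negCount σ * (q : ℂ) ^ invCount σ) *
        ∏ i, inner ℂ (v (absPerm σ i)) (if signs σ i = 1 then w i else J (w i)) := by
  simp only [symmetrizer, LinearMap.sum_apply, LinearMap.smul_apply, map_sum, map_smul,
    form0_act_tprod, l1_eq_negCount, l2_eq_invCount, smul_eq_mul]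

lemma prod_inner_insertLast (J : H →L[ℂ] H) (x : H) {n : ℕ} (k : Fin (n + 1)) (s : ℤˣ)
    (σ : SignedPerm n) (v : Fin n → H) (w : Fin (n + 1) → H) :
    ∏ i, inner ℂ (Fin.snoc (α := fun _ => H) v x (absPerm (insertLast k s σ) i))
        (if signs (insertLast k s σ) i = 1 then w i else J (w i)) =
      inner ℂ x (if s = 1 then w k else J (w k)) *
        ∏ i, inner ℂ (v (absPerm σ i))
          (if signs σ i = 1 then w (k.succAbove i) else J (w (k.succAbove i))) := by
  rw [Fin.prod_univ_succAbove _ k]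
  simp only [absPerm_insertLast_self, absPerm_insertLast_succAbove, signs_insertLast_self,
    signs_insertLast_succAbove, Fin.snoc_last, Fin.snoc_castSucc]

lemma annihilateLevel_tprod (α q : ℝ) (J : H →L[ℂ] H) (x : H) {n : ℕ} (w : Fin (n + 1) → H) :
    annihilateLevel α q J x n (PiTensorProduct.tprod ℂ w) =
      ∑ k : Fin (n + 1), ((q : ℂ) ^ (n - k.val) * inner ℂ x (w k) +
        (α : ℂ) * (q : ℂ) ^ n * (q : ℂ) ^ k.val * inner ℂ x (J (w k))) •
          PiTensorProduct.tprod ℂ (fun i => w (k.succAbove i)) := by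
  simp only [annihilateLevel, LinearMap.add_apply, LinearMap.smul_apply, LinearMap.sum_apply,
    contract_tprod, Finset.smul_sum, smul_smul, add_smul, Finset.sum_add_distrib,
    LinearMap.comp_apply, innerₛₗ_apply_apply, mul_assoc]
  rfl

/-- The sum over `Σ(n+1)` is split by the place and the sign of the largest letter, which is the one
paired with `x`. -/
lemma form0_appendRight_tprod (α q : ℝ) (J : H →L[ℂ] H) (x : H) {n : ℕ} (v : Fin n → H)
    (w : Fin (n + 1) → H) :
    form0 H (n + 1) (appendRight x n (PiTensorProduct.tprod ℂ v))
        (symmetrizer α q J (n + 1) (PiTensorProduct.tprod ℂ w)) =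
      form0 H n (PiTensorProduct.tprod ℂ v)
        (symmetrizer α q J n (annihilateLevel α q J x n (PiTensorProduct.tprod ℂ w))) := by
  classical
  rw [appendRight_tprod, form0_symmetrizer_tprod, annihilateLevel_tprod]
  simp only [map_sum, map_smul, form0_symmetrizer_tprod]
  rw [← (insertLast_bijective n).sum_comp, Fintype.sum_prod_type]
  refine Finset.sum_congr rfl fun k _ => ?_
  rw [Fintype.sum_prod_type, smul_eq_mul, Finset.mul_sum, Finset.sum_comm]
  refine Finset.sum_congr rfl fun σ _ => ?_
  -- The exponent of `q` for a negative letter, in the form `q^n q^k` that occurs in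
  -- `annihilateLevel`.
  have hk : n - k.val + 2 * k.val = n + k.val := by have := k.isLt; omega
  rw [show (Finset.univ : Finset ℤˣ) = {1, -1} from rfl, Finset.sum_pair (by decide)]
  have h1 : (1 : ℤˣ) ≠ -1 := by decide
  simp only [prod_inner_insertLast, negCount_insertLast, invCount_insertLast, if_neg h1,
    if_neg h1.symm, if_true, hk]
  ring

lemma form0_appendRight (α q : ℝ) (J : H →L[ℂ] H) (x : H) {n : ℕ} (a : ⨂[ℂ]^n H)
    (b : ⨂[ℂ]^(n + 1) H) :
    form0 H (n + 1) (appendRight x n a) (symmetrizer α q J (n + 1) b) =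
      form0 H n a (symmetrizer α q J n (annihilateLevel α q J x n b)) := by
  induction a using PiTensorProduct.induction_on with
  | smul_tprod r v =>
    simp only [map_smulₛₗ, LinearMap.smul_apply]
    congr 1
    induction b using PiTensorProduct.induction_on with
    | smul_tprod r w => simp only [map_smul, form0_appendRight_tprod]
    | add b c hb hc => simp only [map_add, hb, hc]
  | add a c ha hc => simp only [map_add, LinearMap.add_apply, ha, hc]

lemma creation_incl (x : H) {n : ℕ} (a : ⨂[ℂ]^n H) :
    creation x (incl n a) = incl (n + 1) (appendRight x n a) := by
  rw [creation, incl, DirectSum.toModule_lof, LinearMap.comp_apply]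

lemma annihilation_incl_succ (α q : ℝ) (J : H →L[ℂ] H) (x : H) {n : ℕ} (a : ⨂[ℂ]^(n + 1) H) :
    annihilation α q J x (incl (n + 1) a) = incl n (annihilateLevel α q J x n a) := by
  rw [annihilation, incl, DirectSum.toModule_lof, LinearMap.comp_apply]

lemma annihilation_incl_zero (α q : ℝ) (J : H →L[ℂ] H) (x : H) (a : ⨂[ℂ]^0 H) :
    annihilation α q J x (incl 0 a) = 0 := by
  rw [annihilation, incl, DirectSum.toModule_lof, LinearMap.zero_apply]

/-- Needed for arbitrary `g`: in the adjointness proof only the left argument is decomposed into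
homogeneous parts. -/
lemma annihilation_apply (α q : ℝ) (J : H →L[ℂ] H) (x : H) (g : Fock H) (n : ℕ) :
    annihilation α q J x g n = annihilateLevel α q J x n (g (n + 1)) := by
  induction g using DirectSum.induction_on with
  | zero => simp
  | add f g hf hg => simp only [map_add, DirectSum.add_apply, hf, hg]
  | of m a =>
    change (annihilation α q J x (incl m a)) n = annihilateLevel α q J x n ((incl m a) (n + 1))
    cases m with
    | zero =>
      rw [annihilation_incl_zero, incl, DirectSum.lof_eq_of, DirectSum.of_eq_of_ne _ _ _ (by omega),
        map_zero, DirectSum.zero_apply]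
    | succ m =>
      rw [annihilation_incl_succ]
      by_cases h : m = n
      · subst h
        rw [incl, incl, DirectSum.lof_apply, DirectSum.lof_apply]
      · rw [incl, incl, DirectSum.lof_eq_of, DirectSum.lof_eq_of,
          DirectSum.of_eq_of_ne _ _ _ (Ne.symm h), DirectSum.of_eq_of_ne _ _ _ (by omega), map_zero]

lemma fockInner_add_left (α q : ℝ) (J : H →L[ℂ] H) (f f' g : Fock H) :
    fockInner α q J (f + f') g = fockInner α q J f g + fockInner α q J f' g := by
  classical
  -- A sum over all degrees replaces the sum over the support, since `f`, `f'` and `f + f'` have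
  -- different supports.
  have h : ∀ f g : Fock H, fockInner α q J f g =
      ∑ᶠ n, form0 H n (f n) (symmetrizer α q J n (g n)) := fun f g => by
    rw [fockInner, finsum_eq_sum_of_support_subset]
    intro n hn
    simp only [Function.mem_support, Finset.mem_coe, DFinsupp.mem_support_toFun] at hn ⊢
    rintro h0
    refine hn ?_
    rw [show f n = 0 from h0, map_zero, LinearMap.zero_apply]
  have hf : ∀ f g : Fock H, (Function.support fun n =>
      form0 H n (f n) (symmetrizer α q J n (g n))).Finite := fun f g => by
    refine (DFinsupp.support f).finite_toSet.subset fun n hn => ?_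
    simp only [Function.mem_support, Finset.mem_coe, DFinsupp.mem_support_toFun] at hn ⊢
    rintro h0
    refine hn ?_
    rw [show f n = 0 from h0, map_zero, LinearMap.zero_apply]
  rw [h, h, h, ← finsum_add_distrib (hf f g) (hf f' g)]
  simp only [DirectSum.add_apply, map_add, LinearMap.add_apply]

lemma fockInner_zero_left (α q : ℝ) (J : H →L[ℂ] H) (g : Fock H) : fockInner α q J 0 g = 0 := by
  have h := fockInner_add_left α q J 0 0 g
  rw [add_zero] at h
  exact left_eq_add.1 h

lemma fockInner_incl (α q : ℝ) (J : H →L[ℂ] H) {n : ℕ} (a : ⨂[ℂ]^n H) (g : Fock H) :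
    fockInner α q J (incl n a) g = form0 H n a (symmetrizer α q J n (g n)) := by
  classical
  rw [fockInner, Finset.sum_eq_single n]
  · rw [incl, DirectSum.lof_apply]
  · intro m _ hm
    rw [incl, DirectSum.lof_eq_of, DirectSum.of_eq_of_ne _ _ _ hm, map_zero, LinearMap.zero_apply]
  · intro h
    have h0 : (incl n a : Fock H) n = 0 := by
      simpa only [DFinsupp.mem_support_toFun, not_not] using h
    rw [h0, map_zero, LinearMap.zero_apply]

lemma isAdjointFor_creation_annihilation (α q : ℝ) (J : H →L[ℂ] H) (x : H) :
    IsAdjointFor α q J (creation x) (annihilation α q J x) := by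
  intro f g
  induction f using DirectSum.induction_on with
  | zero => rw [map_zero, fockInner_zero_left, fockInner_zero_left]
  | add f f' hf hf' => rw [map_add, fockInner_add_left, fockInner_add_left, hf, hf']
  | of n a =>
    change fockInner α q J (creation x (incl n a)) g = fockInner α q J (incl n a) _
    rw [creation_incl, fockInner_incl, fockInner_incl, annihilation_apply, form0_appendRight]

/-! ### The action on the powers of a vector -/

/-- The vector `x ⊗ ⋯ ⊗ x` in the Fock space. -/
def powVec (x : H) (n : ℕ) : Fock H := incl n (PiTensorProduct.tprod ℂ fun _ => x)

lemma powVec_zero (x : H) : powVec x 0 = vacuum := by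
  rw [powVec, vacuum]
  congr 2
  exact Subsingleton.elim _ _

/-- The Jacobi coefficients `[n]_q (1 + α q^{n-1})`, with `0` for `n = 0`. -/
def jacobiCoeff (α q : ℝ) (n : ℕ) : ℝ := qNat q n * (1 + α * q ^ (n - 1))

lemma creation_powVec (x : H) (n : ℕ) : creation x (powVec x n) = powVec x (n + 1) := by
  rw [powVec, creation_incl, appendRight_tprod, powVec]
  congr 2
  ext1 i
  induction i using Fin.lastCases <;> simp

lemma qNat_eq_sum_fin (q : ℝ) (n : ℕ) : (qNat q n : ℂ) = ∑ k : Fin n, (q : ℂ) ^ k.val := by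
  rw [qNat, ← Fin.sum_univ_eq_sum_range]
  push_cast
  rfl

/-- The involution enters only through the factor `s` on the second sum, that is, by replacing `α`
with `s * α`; the theorem uses `s = 1` and `s = -1`. -/
lemma annihilation_powVec_succ (α q : ℝ) {J : H →L[ℂ] H} {x : H} (hx : ‖x‖ = 1) {s : ℝ}
    (hJ : J x = (s : ℂ) • x) (n : ℕ) :
    annihilation α q J x (powVec x (n + 1)) =
      (jacobiCoeff (s * α) q (n + 1) : ℂ) • powVec x n := by
  have hxx : inner ℂ x x = (1 : ℂ) := by rw [inner_self_eq_norm_sq_to_K, hx]; simp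
  rw [powVec, annihilation_incl_succ, annihilateLevel_tprod, ← Finset.sum_smul, map_smul, powVec]
  congr 1
  simp only [hJ, inner_smul_right, hxx, Finset.sum_add_distrib, mul_one]
  -- Reversing the order of summation turns the powers `q^(n-k)` into `q^k`.
  rw [← Equiv.sum_comp Fin.revPerm, ← Finset.sum_mul, ← Finset.mul_sum]
  simp only [jacobiCoeff, Complex.ofReal_mul, Complex.ofReal_add, Complex.ofReal_one,
    Complex.ofReal_pow, Nat.add_sub_cancel, qNat_eq_sum_fin]
  have : ∀ i : Fin (n + 1), n - (Fin.revPerm i).val = i.val := fun i => by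
    simp [Fin.val_rev]; omega
  simp only [this]
  ring

lemma annihilation_powVec_zero (α q : ℝ) (J : H →L[ℂ] H) (x : H) :
    annihilation α q J x (powVec x 0) = 0 := annihilation_incl_zero _ _ _ _ _

lemma piOp_zero_tprod_const {J : H →L[ℂ] H} {x : H} {s : ℝ} (hJ : J x = (s : ℂ) • x) (n : ℕ) :
    piOp J (n + 1) 0 (PiTensorProduct.tprod ℂ fun _ => x) =
      (s : ℂ) • PiTensorProduct.tprod ℂ fun _ => x := by
  rw [piOp, dif_pos (Nat.succ_pos n), act_tprod]
  have h : ∀ k : Fin (n + 1), (absPerm (gen (n + 1) ⟨0, Nat.succ_pos n⟩)).symm k = k := fun k => by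
    rw [Equiv.symm_apply_eq, absPerm_gen_zero rfl]
  have h' : (fun k : Fin (n + 1) => if (if k = 0 then (-1 : ℤˣ) else 1) = 1 then x
      else (s : ℂ) • x) = fun k => (if k = 0 then (s : ℂ) else 1) • x := by
    ext1 k
    split_ifs with h1 h2 h2
    · exact absurd h2 (by decide)
    · rfl
    · rw [one_smul]
    · exact absurd rfl h2
  simp only [h, signs_gen_zero (i := (⟨0, Nat.succ_pos n⟩ : Fin (n + 1))) rfl, hJ]
  refine (congrArg (PiTensorProduct.tprod ℂ) h').trans ?_
  rw [MultilinearMap.map_smul_univ, Finset.prod_ite_eq' Finset.univ (0 : Fin (n + 1)),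
    if_pos (Finset.mem_univ _)]

lemma piOp_tprod_const (J : H →L[ℂ] H) (x : H) (n : ℕ) {i : ℕ} (hi : i ≠ 0) :
    piOp J n i (PiTensorProduct.tprod ℂ fun _ => x) = PiTensorProduct.tprod ℂ fun _ => x := by
  rw [piOp]
  split_ifs with h
  · rw [act_tprod]
    simp [signs_gen (i := ⟨i, h⟩) hi]
  · rfl

lemma list_prod_apply_eigenvector {V : Type*} [AddCommGroup V] [Module ℂ V] (v : V)
    (l : List (Module.End ℂ V)) (h : ∀ f ∈ l, f v = v) : l.prod v = v := by
  induction l with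
  | nil => rfl
  | cons f l ih =>
    rw [List.prod_cons, Module.End.mul_apply, ih fun g hg => h g (List.mem_cons_of_mem _ hg),
      h f List.mem_cons_self]

lemma sum_Icc_pow (q : ℝ) (n : ℕ) :
    1 + ∑ k ∈ Finset.Icc 1 n, (q : ℂ) ^ k = (qNat q (n + 1) : ℂ) := by
  rw [qNat, Finset.sum_range_succ', pow_zero, Complex.ofReal_add, Complex.ofReal_one, add_comm,
    Finset.range_eq_Ico, Finset.sum_Ico_add' (fun i => q ^ i) 0 n 1]
  push_cast
  rfl

/-- Every `πᵢ` with `i ≥ 1` fixes the tensor and `π₀` multiplies it by `s`, so both brackets become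
`[n+1]_q` and the long word contributes one factor `s`. -/
lemma opR_tprod_const (α q : ℝ) {J : H →L[ℂ] H} {x : H} {s : ℝ} (hJ : J x = (s : ℂ) • x) (n : ℕ) :
    opR α q J (n + 1) (PiTensorProduct.tprod ℂ fun _ => x) =
      (jacobiCoeff (s * α) q (n + 1) : ℂ) • PiTensorProduct.tprod ℂ fun _ => x := by
  set v : ⨂[ℂ]^(n + 1) H := PiTensorProduct.tprod ℂ fun _ => x
  have h1 : ∀ k ∈ Finset.Icc 1 n,
      ((List.range k).map (fun j => piOp J (n + 1) (n - j))).prod v = v := fun k hk => by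
    refine list_prod_apply_eigenvector v _ fun f hf => ?_
    obtain ⟨j, hj, rfl⟩ := List.mem_map.1 hf
    exact piOp_tprod_const J x _ (by
      have := List.mem_range.1 hj; have := (Finset.mem_Icc.1 hk).2; omega)
  have h2 : ∀ k ∈ Finset.Icc 1 n,
      ((List.range k).map (fun j => piOp J (n + 1) (j + 1))).prod v = v := fun k hk => by
    refine list_prod_apply_eigenvector v _ fun f hf => ?_
    obtain ⟨j, hj, rfl⟩ := List.mem_map.1 hf
    exact piOp_tprod_const J x _ (by omega)
  -- The index `j = n` gives the rightmost letter `π₀`, which acts first.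
  have h3 : ((List.range (n + 1)).map (fun j => piOp J (n + 1) (n - j))).prod v = (s : ℂ) • v := by
    rw [List.range_succ, List.map_append, List.prod_append, Module.End.mul_apply, List.map_singleton,
      List.prod_singleton, Nat.sub_self, piOp_zero_tprod_const hJ, map_smul]
    congr 1
    refine list_prod_apply_eigenvector v _ fun f hf => ?_
    obtain ⟨j, hj, rfl⟩ := List.mem_map.1 hf
    exact piOp_tprod_const J x _ (by have := List.mem_range.1 hj; omega)
  simp only [opR, Nat.add_sub_cancel, LinearMap.add_apply, LinearMap.smul_apply,
    Module.End.mul_apply, LinearMap.sum_apply, Module.End.one_apply]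
  have h5 := Finset.sum_congr rfl fun k hk => congrArg (fun w => (q : ℂ) ^ k • w) (h1 k hk)
  have h6 := Finset.sum_congr rfl fun k hk => congrArg (fun w => (q : ℂ) ^ k • w) (h2 k hk)
  have h4 : v + ∑ k ∈ Finset.Icc 1 n, (q : ℂ) ^ k • v = (qNat q (n + 1) : ℂ) • v := by
    rw [← sum_Icc_pow, add_smul, one_smul, Finset.sum_smul]
  rw [h5, h6, h4, map_smul, h3, smul_smul, smul_smul, ← add_smul]
  congr 1
  rw [jacobiCoeff, Nat.add_sub_cancel]
  push_cast
  ring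

lemma gaugeZero_id (n : ℕ) : gaugeZero (ContinuousLinearMap.id ℂ H) n = 1 := by
  rw [gaugeZero, Module.End.one_eq_id, ← PiTensorProduct.map_id]
  congr 1
  ext1 i
  split_ifs <;> rfl

lemma gauge_powVec (α q : ℝ) {J : H →L[ℂ] H} {x : H} {s : ℝ} (hJ : J x = (s : ℂ) • x) (n : ℕ) :
    gauge α q J (ContinuousLinearMap.id ℂ H) (powVec x n) =
      (jacobiCoeff (s * α) q n : ℂ) • powVec x n := by
  cases n with
  | zero =>
    rw [gauge, powVec, incl, DirectSum.toModule_lof]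
    simp [jacobiCoeff, qNat]
  | succ n =>
    rw [gauge, powVec, incl, DirectSum.toModule_lof, LinearMap.comp_apply, Module.End.mul_apply,
      opR_tprod_const α q hJ, gaugeZero_id, Module.End.one_apply, map_smul]

/-- The operator acts on the tensor powers of `x` by the three-term recurrence that defines the
polynomials. -/
lemma aeval_opB_vacuum (α q : ℝ) {J : H →L[ℂ] H} {x : H} (hx : ‖x‖ = 1) {s : ℝ}
    (hJ : J x = (s : ℂ) • x) (n : ℕ) :
    Polynomial.aeval (R := ℝ) (opB α q J (ContinuousLinearMap.id ℂ H) x)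
      (poissonPoly (s * α) q n) vacuum = powVec x n := by
  induction n using Nat.twoStepInduction with
  | zero => simp [poissonPoly, powVec_zero]
  | one =>
    rw [poissonPoly, Polynomial.aeval_X, ← powVec_zero x, opB, LinearMap.add_apply,
      LinearMap.add_apply, annihilation_powVec_zero, creation_powVec, gauge_powVec α q hJ]
    simp [jacobiCoeff, qNat]
  | more n ih1 ih2 =>
    have hc : qNat q (n + 1) * (1 + s * α * q ^ n) = jacobiCoeff (s * α) q (n + 1) := by
      rw [jacobiCoeff, Nat.add_sub_cancel]
    rw [poissonPoly, hc]
    simp only [map_sub, map_mul, Polynomial.aeval_X, Polynomial.aeval_C, LinearMap.sub_apply,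
      Module.End.mul_apply, ih1, ih2, Module.algebraMap_end_apply]
    rw [opB, LinearMap.add_apply, LinearMap.add_apply, annihilation_powVec_succ α q hx hJ,
      creation_powVec, gauge_powVec α q hJ]
    simp only [← Complex.coe_smul]
    abel

lemma vacuumState_aeval_poissonPoly (α q : ℝ) {J : H →L[ℂ] H} {x : H} (hx : ‖x‖ = 1) {s : ℝ}
    (hJ : J x = (s : ℂ) • x) (n : ℕ) :
    vacuumState α q J (Polynomial.aeval (R := ℝ) (opB α q J (ContinuousLinearMap.id ℂ H) x)
      (poissonPoly (s * α) q n)) = if n = 0 then 1 else 0 := by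
  classical
  rw [vacuumState, aeval_opB_vacuum α q hx hJ, vacuum, fockInner_incl]
  split_ifs with h
  · subst h
    rw [powVec, incl, DirectSum.lof_apply, form0_symmetrizer_tprod]
    -- `Σ(0)` is trivial, so the symmetrizer has a single term, of weight `1`.
    simp [negCount, invCount, Fintype.card_congr (signedPermEquiv 0)]
  · rw [powVec, incl, DirectSum.lof_eq_of, DirectSum.of_eq_of_ne _ _ _ (Ne.symm h), map_zero,
      map_zero]

/-! ### Orthogonality of the Poisson polynomials -/

open Polynomial MeasureTheory

lemma jacobiCoeff_zero (α q : ℝ) : jacobiCoeff α q 0 = 0 := by simp [jacobiCoeff, qNat]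

/-- At `n = 0` the coefficient vanishes, so the truncated index `n - 1` is harmless and the
recurrence holds uniformly. -/
lemma X_mul_poissonPoly (α q : ℝ) (n : ℕ) :
    X * poissonPoly α q n = poissonPoly α q (n + 1) + C (jacobiCoeff α q n) * poissonPoly α q n +
      C (jacobiCoeff α q n) * poissonPoly α q (n - 1) := by
  cases n with
  | zero => simp [poissonPoly, jacobiCoeff_zero]
  | succ n =>
    rw [poissonPoly, jacobiCoeff, Nat.add_sub_cancel]
    ring

/-- The span contains `1` and, by the recurrence, is stable under multiplication by `X`. -/
lemma span_poissonPoly (α q : ℝ) : Submodule.span ℝ (Set.range (poissonPoly α q)) = ⊤ := by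
  set S := Submodule.span ℝ (Set.range (poissonPoly α q))
  have hP : ∀ n, poissonPoly α q n ∈ S := fun n => Submodule.subset_span ⟨n, rfl⟩
  have hX : ∀ p ∈ S, X * p ∈ S := fun p hp => by
    induction hp using Submodule.span_induction with
    | mem p hp =>
      obtain ⟨n, rfl⟩ := hp
      rw [X_mul_poissonPoly, ← smul_eq_C_mul, ← smul_eq_C_mul]
      exact S.add_mem (S.add_mem (hP _) (S.smul_mem _ (hP _))) (S.smul_mem _ (hP _))
    | zero => rw [mul_zero]; exact S.zero_mem
    | add a b _ _ ha hb => rw [mul_add]; exact S.add_mem ha hb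
    | smul r a _ ha => rw [mul_smul_comm]; exact S.smul_mem _ ha
  have hpow : ∀ n : ℕ, (X : ℝ[X]) ^ n ∈ S := fun n => by
    induction n with
    | zero => exact hP 0
    | succ n ih => rw [pow_succ']; exact hX _ ih
  refine eq_top_iff.2 fun p _ => ?_
  rw [p.as_sum_range_C_mul_X_pow]
  refine S.sum_mem fun i _ => ?_
  rw [← smul_eq_C_mul]
  exact S.smul_mem _ (hpow i)

lemma linearMap_ext_poissonPoly (α q : ℝ) {V : Type*} [AddCommMonoid V] [Module ℝ V]
    {f g : ℝ[X] →ₗ[ℝ] V} (h : ∀ n, f (poissonPoly α q n) = g (poissonPoly α q n)) : f = g :=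
  LinearMap.ext_on_range (span_poissonPoly α q) h

/-- Favard's argument: a factor `X` may be moved from the polynomial of lower index to the other
one. This shifts the index `n` by at most one while `m` drops, so `m < n` persists down to `P₀`. -/
lemma apply_poissonPoly_mul_of_lt {α q : ℝ} {f : ℝ[X] →ₗ[ℝ] ℝ}
    (hf : ∀ n, n ≠ 0 → f (poissonPoly α q n) = 0) (m : ℕ) :
    ∀ n, m < n → f (poissonPoly α q m * poissonPoly α q n) = 0 := by
  induction m using Nat.twoStepInduction with
  | zero => exact fun n hn => by rw [poissonPoly, one_mul, hf n (by omega)]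
  | one =>
    intro n hn
    rw [poissonPoly, X_mul_poissonPoly, ← smul_eq_C_mul, ← smul_eq_C_mul]
    simp [hf (n + 1) (by omega), hf n (by omega), hf (n - 1) (by omega)]
  | more m ih1 ih2 =>
    intro n hn
    -- The product `X * P_{m+1} * P_n` is expanded in two ways.
    have h : poissonPoly α q (m + 2) * poissonPoly α q n =
        poissonPoly α q (m + 1) * poissonPoly α q (n + 1) +
        jacobiCoeff α q n • (poissonPoly α q (m + 1) * poissonPoly α q n) +
        jacobiCoeff α q n • (poissonPoly α q (m + 1) * poissonPoly α q (n - 1)) -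
        jacobiCoeff α q (m + 1) • (poissonPoly α q (m + 1) * poissonPoly α q n) -
        jacobiCoeff α q (m + 1) • (poissonPoly α q m * poissonPoly α q n) := by
      have h1 := X_mul_poissonPoly α q n
      have h2 := X_mul_poissonPoly α q (m + 1)
      rw [Nat.add_sub_cancel] at h2
      simp only [smul_eq_C_mul]
      linear_combination poissonPoly α q (m + 1) * h1 - poissonPoly α q n * h2
    rw [h]
    simp [ih2 (n + 1) (by omega), ih2 n (by omega), ih2 (n - 1) (by omega), ih1 n (by omega)]

/-! ### Moment functionals of measures and of the vacuum state. -/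

lemma integrable_eval {μ : Measure ℝ} (hμ : ∀ n : ℕ, Integrable (fun y : ℝ => y ^ n) μ)
    (p : ℝ[X]) : Integrable (fun y => p.eval y) μ := by
  simp only [eval_eq_sum_range]
  exact integrable_finsetSum _ fun i _ => (hμ i).const_mul _

/-- Integration of polynomials against a measure with finite moments. -/
def polyIntegral (μ : Measure ℝ) (hμ : ∀ n : ℕ, Integrable (fun y : ℝ => y ^ n) μ) :
    ℝ[X] →ₗ[ℝ] ℝ where
  toFun p := ∫ y, p.eval y ∂μ
  map_add' p r := by
    simp only [eval_add]
    exact integral_add (integrable_eval hμ p) (integrable_eval hμ r)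
  map_smul' c p := by
    simp only [eval_smul, smul_eq_mul, RingHom.id_apply]
    exact integral_const_mul _ _

/-- Orthogonality to `P₀ = 1` already forces the other orthogonality relations. -/
lemma isPoissonMeasure_iff (α q : ℝ) (μ : Measure ℝ) :
    IsPoissonMeasure α q μ ↔ IsProbabilityMeasure μ ∧
      (∀ n : ℕ, Integrable (fun y : ℝ => y ^ n) μ) ∧
      ∀ n, ∫ y, (poissonPoly α q n).eval y ∂μ = if n = 0 then 1 else 0 := by
  refine and_congr_right fun hp => and_congr_right fun hi => ⟨fun h n => ?_, fun h m n hmn => ?_⟩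
  · split_ifs with hn
    · subst hn; simp [poissonPoly]
    · have := h 0 n (Ne.symm hn)
      simpa [poissonPoly] using this
  · have hf : ∀ n, n ≠ 0 → polyIntegral μ hi (poissonPoly α q n) = 0 := fun n hn =>
      (h n).trans (if_neg hn)
    simp only [← eval_mul]
    rcases lt_or_gt_of_ne hmn with hlt | hlt
    · exact apply_poissonPoly_mul_of_lt hf m n hlt
    · rw [mul_comm (poissonPoly α q m)]
      exact apply_poissonPoly_mul_of_lt hf n m hlt

/-- The vacuum state on the real polynomials in an operator. -/
def vacuumFunctional (α q : ℝ) (J : H →L[ℂ] H) (B : Module.End ℂ (Fock H)) : ℝ[X] →ₗ[ℝ] ℂ where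
  toFun p := vacuumState α q J (aeval (R := ℝ) B p)
  map_add' p r := by
    simp only [vacuumState, vacuum, fockInner_incl, map_add, LinearMap.add_apply,
      DirectSum.add_apply]
  map_smul' c p := by
    simp only [vacuumState, vacuum, fockInner_incl, map_smul, LinearMap.smul_apply,
      RingHom.id_apply]
    rw [← Complex.coe_smul, DirectSum.smul_apply, map_smul, map_smul, Complex.coe_smul]

/-- Both sides say that the vacuum functional equals integration against `μ`: one tests this on the
monomials, the other on the spanning family `P_n`. -/
lemma isVacuumDistribution_iff_isPoissonMeasure (α q : ℝ) {J : H →L[ℂ] H} {x : H}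
    (hx : ‖x‖ = 1) {s : ℝ} (hJ : J x = (s : ℂ) • x) (μ : Measure ℝ) :
    IsVacuumDistribution α q J (opB α q J (ContinuousLinearMap.id ℂ H) x) μ ↔
      IsPoissonMeasure (s * α) q μ := by
  rw [isPoissonMeasure_iff]
  refine and_congr_right fun hp => and_congr_right fun hi => ?_
  set B := opB α q J (ContinuousLinearMap.id ℂ H) x
  have h1 : (∀ n : ℕ, vacuumState α q J (B ^ n) = ((∫ y, y ^ n ∂μ : ℝ) : ℂ)) ↔
      vacuumFunctional α q J B = Algebra.linearMap ℝ ℂ ∘ₗ polyIntegral μ hi := by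
    constructor
    · intro h
      refine Polynomial.lhom_ext' fun n => LinearMap.ext_ring ?_
      have h2 : vacuumFunctional α q J B (X ^ n) = Algebra.linearMap ℝ ℂ (polyIntegral μ hi (X ^ n)) := by
        simpa [vacuumFunctional, polyIntegral] using h n
      simpa [X_pow_eq_monomial] using h2
    · intro h n
      have h2 := congrArg (fun f => f (X ^ n)) h
      simpa [vacuumFunctional, polyIntegral] using h2
  rw [h1]
  have h3 : ∀ n, vacuumFunctional α q J B (poissonPoly (s * α) q n) = if n = 0 then 1 else 0 :=
    vacuumState_aeval_poissonPoly α q hx hJ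
  constructor
  · intro h n
    have h2 := h3 n
    rw [h] at h2
    apply Complex.ofReal_injective
    refine h2.trans ?_
    split_ifs <;> simp
  · intro h
    refine linearMap_ext_poissonPoly (s * α) q fun n => ?_
    rw [h3]
    change _ = ((∫ y, (poissonPoly (s * α) q n).eval y ∂μ : ℝ) : ℂ)
    rw [h]
    split_ifs <;> simp

/-! ### Measures with compact support are determined by their moments -/

/-- Markov's inequality for `y^(2n)` bounds the mass of `|y| ≥ d` by `(c/d)^(2n)`, which tends to
`0` for `d > c`. -/
lemma ae_abs_le_of_moments {μ : Measure ℝ} [IsFiniteMeasure μ] {c : ℝ} (hc : 0 ≤ c)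
    (hi : ∀ n : ℕ, Integrable (fun y : ℝ => y ^ n) μ)
    (h : ∀ n : ℕ, ∫ y, y ^ (2 * n) ∂μ ≤ c ^ (2 * n)) : ∀ᵐ y ∂μ, |y| ≤ c := by
  have key : ∀ d, c < d → μ.real {y | d ≤ |y|} = 0 := fun d hd => by
    have hd0 : 0 < d := hc.trans_lt hd
    have hle : ∀ n : ℕ, μ.real {y | d ≤ |y|} ≤ ((c / d) ^ 2) ^ n := fun n => by
      have h1 := mul_meas_ge_le_integral_of_nonneg (μ := μ) (f := fun y : ℝ => y ^ (2 * n))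
        (Filter.Eventually.of_forall fun y => by
          simp only [Pi.zero_apply]; rw [pow_mul]; positivity) (hi _) (d ^ (2 * n))
      have h2 : {y : ℝ | d ≤ |y|} ⊆ {y : ℝ | d ^ (2 * n) ≤ y ^ (2 * n)} := fun y hy => by
        have h3 : d ^ (2 * n) ≤ |y| ^ (2 * n) := pow_le_pow_left₀ hd0.le hy _
        rwa [(even_two_mul n).pow_abs] at h3
      have h4 := measureReal_mono (μ := μ) h2
      rw [← pow_mul, div_pow, le_div_iff₀ (by positivity)]
      calc _ ≤ d ^ (2 * n) * μ.real {y : ℝ | d ^ (2 * n) ≤ y ^ (2 * n)} := by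
            rw [mul_comm]; gcongr
        _ ≤ _ := h1.trans (h n)
    have hlim : Filter.Tendsto (fun n : ℕ => ((c / d) ^ 2) ^ n) Filter.atTop (nhds 0) := by
      refine tendsto_pow_atTop_nhds_zero_of_lt_one (by positivity) ?_
      rw [sq_lt_one_iff₀ (by positivity)]
      exact (div_lt_one hd0).2 hd
    exact le_antisymm (ge_of_tendsto' hlim hle) measureReal_nonneg
  -- Countably many radii decreasing to `c` keep the exceptional set null.
  have h5 : ∀ n : ℕ, ∀ᵐ y ∂μ, |y| < c + 1 / (n + 1) := fun n => by
    have h6 := key (c + 1 / (n + 1)) (by simp; positivity)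
    rw [ae_iff]
    simpa [measureReal_eq_zero_iff] using h6
  filter_upwards [ae_all_iff.2 h5] with y hy
  refine le_of_forall_pos_le_add fun ε hε => ?_
  obtain ⟨n, hn⟩ := exists_nat_one_div_lt hε
  linarith [hy n]

/-- Bounded continuous functions determine a finite measure; on `[-c, c]`, which carries both
measures, they are uniform limits of polynomials. -/
lemma measure_eq_of_integral_eval_eq {μ ν : Measure ℝ} [IsProbabilityMeasure μ]
    [IsProbabilityMeasure ν] {c : ℝ} (hμ : ∀ᵐ y ∂μ, |y| ≤ c) (hν : ∀ᵐ y ∂ν, |y| ≤ c)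
    (hiμ : ∀ n : ℕ, Integrable (fun y : ℝ => y ^ n) μ)
    (hiν : ∀ n : ℕ, Integrable (fun y : ℝ => y ^ n) ν)
    (h : ∀ p : ℝ[X], ∫ y, p.eval y ∂μ = ∫ y, p.eval y ∂ν) : μ = ν := by
  refine ext_of_forall_integral_eq_of_IsFiniteMeasure fun f => ?_
  have key : ∀ ε > 0, |∫ y, f y ∂μ - ∫ y, f y ∂ν| ≤ ε := fun ε hε => by
    obtain ⟨p, hp⟩ := exists_polynomial_near_of_continuousOn (-c) c f f.continuous.continuousOn
      (ε / 2) (half_pos hε)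
    have hdiff : ∀ (ρ : Measure ℝ) [IsProbabilityMeasure ρ], (∀ᵐ y ∂ρ, |y| ≤ c) →
        (∀ n : ℕ, Integrable (fun y : ℝ => y ^ n) ρ) →
        |∫ y, f y ∂ρ - ∫ y, p.eval y ∂ρ| ≤ ε / 2 := fun ρ _ hρ hi => by
      rw [← integral_sub (f.integrable ρ) (integrable_eval hi p), ← Real.norm_eq_abs]
      have := norm_integral_le_of_norm_le_const (μ := ρ) (C := ε / 2)
        (f := fun y => f y - p.eval y) (by
          filter_upwards [hρ] with y hy
          rw [Real.norm_eq_abs, abs_sub_comm]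
          exact (hp y (abs_le.1 hy)).le)
      simpa using this
    have h1 := hdiff μ hμ hiμ
    have h2 := hdiff ν hν hiν
    rw [h p] at h1
    rw [abs_le] at *
    constructor <;> linarith [h1.1, h1.2, h2.1, h2.2]
  exact sub_eq_zero.1 (abs_eq_zero.1 (le_antisymm
    (le_of_forall_pos_le_add fun ε hε => by simpa using key ε hε) (abs_nonneg _)))

/-! ### Existence of the orthogonality measure -/

lemma qNat_pos {q : ℝ} (hq : q ∈ Set.Ioo (-1 : ℝ) 1) {n : ℕ} (hn : n ≠ 0) : 0 < qNat q n := by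
  -- In `(q^n - 1)/(q - 1)` both terms are negative, also when `q < 0`.
  rw [qNat, geom_sum_eq (ne_of_lt hq.2)]
  refine div_pos_of_neg_of_neg ?_ (by linarith [hq.2])
  have h : |q ^ n| < 1 := by
    rw [abs_pow]
    exact pow_lt_one₀ (abs_nonneg _) (abs_lt.2 hq) hn
  linarith [(abs_lt.1 h).2]

lemma qNat_le {q : ℝ} (hq : q ∈ Set.Ioo (-1 : ℝ) 1) (n : ℕ) : qNat q n ≤ 2 / (1 - q) := by
  have h0 : 0 < 1 - q := by linarith [hq.2]
  rw [qNat, le_div_iff₀ h0, geom_sum_mul_neg]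
  have h : |q ^ n| ≤ 1 := by
    rw [abs_pow]
    exact pow_le_one₀ (abs_nonneg _) (abs_lt.2 hq).le
  linarith [(abs_le.1 h).1]

lemma abs_mul_pow_lt_one {α q : ℝ} (hα : α ∈ Set.Ioo (-1 : ℝ) 1) (hq : q ∈ Set.Ioo (-1 : ℝ) 1)
    (n : ℕ) : |α * q ^ n| < 1 := by
  rw [abs_mul, abs_pow]
  exact (mul_le_of_le_one_right (abs_nonneg _) (pow_le_one₀ (abs_nonneg _) (abs_lt.2 hq).le)).trans_lt
    (abs_lt.2 hα)

lemma jacobiCoeff_pos {α q : ℝ} (hα : α ∈ Set.Ioo (-1 : ℝ) 1) (hq : q ∈ Set.Ioo (-1 : ℝ) 1)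
    {n : ℕ} (hn : n ≠ 0) : 0 < jacobiCoeff α q n :=
  mul_pos (qNat_pos hq hn) (by linarith [(abs_lt.1 (abs_mul_pow_lt_one hα hq (n - 1))).1])

lemma jacobiCoeff_nonneg {α q : ℝ} (hα : α ∈ Set.Ioo (-1 : ℝ) 1) (hq : q ∈ Set.Ioo (-1 : ℝ) 1)
    (n : ℕ) : 0 ≤ jacobiCoeff α q n := by
  rcases eq_or_ne n 0 with rfl | hn
  · rw [jacobiCoeff_zero]
  · exact (jacobiCoeff_pos hα hq hn).le

lemma jacobiCoeff_le {α q : ℝ} (hα : α ∈ Set.Ioo (-1 : ℝ) 1) (hq : q ∈ Set.Ioo (-1 : ℝ) 1)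
    (n : ℕ) : jacobiCoeff α q n ≤ 4 / (1 - q) := by
  have h0 : 0 < 1 - q := by linarith [hq.2]
  have h1 := abs_lt.1 (abs_mul_pow_lt_one hα hq (n - 1))
  calc jacobiCoeff α q n ≤ 2 / (1 - q) * 2 :=
        mul_le_mul (qNat_le hq n) (by linarith [h1.2]) (by linarith [h1.1]) (by positivity)
    _ = 4 / (1 - q) := by ring

/-- The truncated symmetric Jacobi matrix with the diagonal `lam k` and the off-diagonal entries
`√(lam (k + 1))`. -/
def jacobiMatrix (lam : ℕ → ℝ) (N : ℕ) : Matrix (Fin (N + 1)) (Fin (N + 1)) ℝ :=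
  Matrix.of fun i j => (if i = j then lam i else 0) +
    (if i.val + 1 = j.val then √(lam j) else 0) + (if j.val + 1 = i.val then √(lam i) else 0)

lemma jacobiMatrix_isHermitian (lam : ℕ → ℝ) (N : ℕ) : (jacobiMatrix lam N).IsHermitian := by
  refine Matrix.IsHermitian.ext fun i j => ?_
  simp only [jacobiMatrix, Matrix.of_apply, star_trivial, eq_comm (a := i) (b := j)]
  rw [add_right_comm]
  congr 2
  split_ifs with h
  · rw [h]
  · rfl

/-- A vector extended by `0`. -/
def extendZero {N : ℕ} (u : Fin (N + 1) → ℝ) (k : ℕ) : ℝ := if h : k < N + 1 then u ⟨k, h⟩ else 0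

lemma sum_ite_val_eq {N : ℕ} (u : Fin (N + 1) → ℝ) (c : ℕ → ℝ) (k : ℕ) :
    ∑ j : Fin (N + 1), (if k = j.val then c j else 0) * u j = c k * extendZero u k := by
  rw [extendZero]
  split_ifs with h
  · rw [Finset.sum_eq_single ⟨k, h⟩]
    · simp
    · intro j _ hj
      rw [if_neg fun h => hj (Fin.ext h.symm), zero_mul]
    · simp
  · rw [mul_zero]
    refine Finset.sum_eq_zero fun j _ => ?_
    rw [if_neg (by have := j.isLt; omega), zero_mul]

/-- Extension by zero absorbs the cut at the last row, and `lam 0 = 0` removes the spurious term `k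
- 1 = 0` in the first row. -/
lemma jacobiMatrix_mulVec {lam : ℕ → ℝ} (h0 : lam 0 = 0) {N : ℕ} (u : Fin (N + 1) → ℝ)
    (k : Fin (N + 1)) : (jacobiMatrix lam N).mulVec u k =
      lam k * extendZero u k + √(lam (k + 1)) * extendZero u (k + 1) +
        √(lam k) * extendZero u (k - 1) := by
  simp only [Matrix.mulVec, dotProduct, jacobiMatrix, Matrix.of_apply, add_mul,
    Finset.sum_add_distrib]
  congr 1
  · congr 1
    · rw [← sum_ite_val_eq]
      refine Finset.sum_congr rfl fun j _ => ?_
      simp only [Fin.ext_iff]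
      split_ifs with h
      · rw [h]
      · rfl
    · exact sum_ite_val_eq u (fun j => √(lam j)) (k + 1)
  · rcases Nat.eq_zero_or_pos k.val with hk | hk
    · rw [hk, h0, Real.sqrt_zero, zero_mul]
      exact Finset.sum_eq_zero fun j _ => by rw [if_neg (by omega), zero_mul]
    · rw [← sum_ite_val_eq u (fun _ => √(lam k))]
      refine Finset.sum_congr rfl fun j _ => ?_
      congr 1
      exact if_congr (by omega) rfl rfl

lemma extendZero_abs_le {N : ℕ} {u : Fin (N + 1) → ℝ} {c : ℝ} (h : ∀ i, |u i| ≤ c) (k : ℕ) :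
    |extendZero u k| ≤ c := by
  rw [extendZero]
  split_ifs
  · exact h _
  · rw [abs_zero]
    exact (abs_nonneg _).trans (h 0)

/-- Gershgorin's argument: in the row where `|u k|` is maximal there are at most three nonzero
entries, each at most `b`. -/
lemma abs_le_of_eigenvector {lam : ℕ → ℝ} (h0 : lam 0 = 0) {b : ℝ} (hb : 1 ≤ b)
    (hl : ∀ n, 0 ≤ lam n) (hlb : ∀ n, lam n ≤ b) {N : ℕ} {u : Fin (N + 1) → ℝ} (hu : u ≠ 0)
    {d : ℝ} (hd : (jacobiMatrix lam N).mulVec u = d • u) : |d| ≤ 3 * b := by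
  obtain ⟨k, hk⟩ := Finite.exists_max fun i => |u i|
  have hpos : 0 < |u k| := by
    obtain ⟨i, hi⟩ := Function.ne_iff.1 hu
    exact (abs_pos.2 hi).trans_le (hk i)
  -- Here `1 ≤ b` matters: `lam n ≤ b ≤ b ^ 2`.
  have hs : ∀ n, √(lam n) ≤ b := fun n => by
    rw [Real.sqrt_le_left (by linarith)]
    nlinarith [hlb n]
  have h1 := congrFun hd k
  rw [jacobiMatrix_mulVec h0, Pi.smul_apply, smul_eq_mul] at h1
  have h2 : ∀ (c : ℝ) (n : ℕ), 0 ≤ c → c ≤ b → |c * extendZero u n| ≤ b * |u k| := fun c n hc hcb => by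
    rw [abs_mul, abs_of_nonneg hc]
    exact mul_le_mul hcb (extendZero_abs_le hk n) (abs_nonneg _) (by linarith)
  have h3 : |d| * |u k| ≤ 3 * b * |u k| := by
    rw [← abs_mul, ← h1]
    refine (abs_add_three _ _ _).trans ?_
    linarith [h2 _ k.val (hl k) (hlb k), h2 _ (k.val + 1) (Real.sqrt_nonneg _) (hs (k + 1)),
      h2 _ (k.val - 1) (Real.sqrt_nonneg _) (hs k)]
  exact le_of_mul_le_mul_right h3 hpos

/-- The coordinates of an eigenvector, rescaled by the products of square roots, satisfy the
recurrence of the `P_k` at the eigenvalue, so the first coordinate determines them all. The last row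
of the matrix is not needed for this. -/
lemma poissonPoly_eval_mul_eigenvector {α q : ℝ} (hα : α ∈ Set.Ioo (-1 : ℝ) 1)
    (hq : q ∈ Set.Ioo (-1 : ℝ) 1) {N : ℕ} {u : Fin (N + 1) → ℝ} {d : ℝ}
    (hd : (jacobiMatrix (jacobiCoeff α q) N).mulVec u = d • u) (k : ℕ) (hk : k < N + 1) :
    (poissonPoly α q k).eval d * u 0 =
      (∏ i ∈ Finset.range k, √(jacobiCoeff α q (i + 1))) * extendZero u k := by
  have hu : ∀ k (hk : k < N + 1), jacobiCoeff α q k * extendZero u k +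
      √(jacobiCoeff α q (k + 1)) * extendZero u (k + 1) +
        √(jacobiCoeff α q k) * extendZero u (k - 1) = d * extendZero u k := fun k hk => by
    have h1 := congrFun hd ⟨k, hk⟩
    rw [jacobiMatrix_mulVec (jacobiCoeff_zero α q), Pi.smul_apply, smul_eq_mul] at h1
    rw [h1, extendZero, dif_pos hk]
  induction k using Nat.twoStepInduction with
  | zero => simp [poissonPoly, extendZero]
  | one =>
    have h1 := hu 0 (by omega)
    rw [jacobiCoeff_zero, Real.sqrt_zero] at h1
    have h2 : extendZero u 0 = u 0 := by simp [extendZero]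
    rw [h2] at h1
    simp only [poissonPoly, eval_X, Finset.prod_range_one, zero_add] at h1 ⊢
    linarith
  | more n ih1 ih2 =>
    have h1 := hu (n + 1) (by omega)
    have h2 := ih1 (by omega)
    have h3 := ih2 (by omega)
    have hrec := congrArg (eval d) (X_mul_poissonPoly α q (n + 1))
    simp only [eval_mul, eval_add, eval_X, eval_C, Nat.add_sub_cancel] at hrec h1
    have hsq := Real.mul_self_sqrt (jacobiCoeff_nonneg hα hq (n + 1))
    rw [Finset.prod_range_succ, Finset.prod_range_succ]
    rw [Finset.prod_range_succ] at h3
    set R := ∏ i ∈ Finset.range n, √(jacobiCoeff α q (i + 1))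
    linear_combination (-u 0) * hrec + (d - jacobiCoeff α q (n + 1)) * h3 +
      (-jacobiCoeff α q (n + 1)) * h2 + (-R * √(jacobiCoeff α q (n + 1))) * h1 +
      R * extendZero u n * hsq

/-- Weights and nodes of a quadrature formula that is exact on `P₀, …, P_N`. -/
lemma exists_quadrature {α q : ℝ} (hα : α ∈ Set.Ioo (-1 : ℝ) 1) (hq : q ∈ Set.Ioo (-1 : ℝ) 1)
    {b : ℝ} (hb : 1 ≤ b) (hlb : ∀ n, jacobiCoeff α q n ≤ b) (N : ℕ) :
    ∃ w d : Fin (N + 1) → ℝ, (∀ i, 0 ≤ w i) ∧ (∀ i, |d i| ≤ 3 * b) ∧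
      ∀ n ≤ N, ∑ i, w i * (poissonPoly α q n).eval (d i) = if n = 0 then 1 else 0 := by
  have hA := jacobiMatrix_isHermitian (jacobiCoeff α q) N
  set u := hA.eigenvectorBasis
  have hd := hA.mulVec_eigenvectorBasis
  -- Parseval's identity for the standard vectors `e₀` and `e_k` in the eigenbasis.
  have horth : ∀ k : Fin (N + 1), ∑ i, (u i 0) * (u i k) = if k = 0 then 1 else 0 := fun k => by
    have h := u.sum_inner_mul_inner (EuclideanSpace.single 0 (1 : ℝ)) (EuclideanSpace.single k 1)
    simp [EuclideanSpace.inner_single_left, EuclideanSpace.inner_single_right] at h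
    rw [h]
  -- The nodes are the eigenvalues; the weights, squared first coordinates of the eigenvectors, are
  -- the spectral measure at `e₀`.
  refine ⟨fun i => (u i 0) * (u i 0), hA.eigenvalues, fun i => mul_self_nonneg _, fun i => ?_,
    fun n hn => ?_⟩
  · refine abs_le_of_eigenvector (jacobiCoeff_zero α q) hb (jacobiCoeff_nonneg hα hq) hlb ?_ (hd i)
    intro h
    have h1 : u i = 0 := by ext j; exact congrFun h j
    have h2 := u.orthonormal.1 i
    rw [h1, norm_zero] at h2
    exact zero_ne_one h2
  · have h1 : ∀ i, u i 0 * u i 0 * (poissonPoly α q n).eval (hA.eigenvalues i) =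
        (∏ j ∈ Finset.range n, √(jacobiCoeff α q (j + 1))) *
          (u i 0 * u i ⟨n, by omega⟩) := fun i => by
      have h := poissonPoly_eval_mul_eigenvector hα hq (hd i) n (by omega)
      rw [extendZero, dif_pos (by omega : n < N + 1)] at h
      linear_combination u i 0 * h
    simp only [h1]
    rw [← Finset.mul_sum, horth]
    simp only [Fin.ext_iff, Fin.val_zero]
    split_ifs with h
    · subst h; simp
    · rw [mul_zero]

/-- The quadrature as a discrete measure. It is placed on an interval independent of `N`, so that
all these measures lie in one compact space of probability measures. -/
lemma exists_finite_measure_poissonPoly {α q : ℝ} (hα : α ∈ Set.Ioo (-1 : ℝ) 1)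
    (hq : q ∈ Set.Ioo (-1 : ℝ) 1) {b : ℝ} (hb : 1 ≤ b) (hlb : ∀ n, jacobiCoeff α q n ≤ b)
    (N : ℕ) : ∃ μ : ProbabilityMeasure (Set.Icc (-(3 * b)) (3 * b)), ∀ n ≤ N,
      ∫ y, (poissonPoly α q n).eval (y : ℝ) ∂(μ : Measure (Set.Icc (-(3 * b)) (3 * b))) =
        if n = 0 then 1 else 0 := by
  obtain ⟨w, d, hw, hd, h⟩ := exists_quadrature hα hq hb hlb N
  set ν : Measure (Set.Icc (-(3 * b)) (3 * b)) :=
    ∑ i, ENNReal.ofReal (w i) • Measure.dirac ⟨d i, abs_le.1 (hd i)⟩ with hν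
  have hsum : ∑ i, w i = 1 := by simpa [poissonPoly] using h 0 (Nat.zero_le _)
  have hprob : IsProbabilityMeasure ν := ⟨by
    simp only [hν, Measure.finsetSum_apply, Measure.smul_apply, measure_univ, smul_eq_mul, mul_one]
    rw [← ENNReal.ofReal_sum_of_nonneg fun i _ => hw i, hsum, ENNReal.ofReal_one]⟩
  refine ⟨⟨ν, hprob⟩, fun n hn => ?_⟩
  rw [← h n hn]
  change ∫ y, _ ∂ν = _
  rw [hν, integral_finsetSum_measure]
  · refine Finset.sum_congr rfl fun i _ => ?_
    rw [integral_smul_measure, integral_dirac, ENNReal.toReal_ofReal (hw i), smul_eq_mul]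
  · intro i _
    exact (integrable_dirac (by simp)).smul_measure ENNReal.ofReal_ne_top

lemma exists_measure_poissonPoly {α q : ℝ} (hα : α ∈ Set.Ioo (-1 : ℝ) 1)
    (hq : q ∈ Set.Ioo (-1 : ℝ) 1) : ∃ (c : ℝ) (μ : Measure ℝ), 0 ≤ c ∧ (∀ᵐ y ∂μ, |y| ≤ c) ∧
      IsPoissonMeasure α q μ := by
  set b := max 1 (4 / (1 - q))
  have hb : 1 ≤ b := le_max_left _ _
  have hlb : ∀ n, jacobiCoeff α q n ≤ b := fun n => (jacobiCoeff_le hα hq n).trans (le_max_right _ _)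
  choose μ hμ using exists_finite_measure_poissonPoly hα hq hb hlb
  have hne : Nonempty (ProbabilityMeasure (Set.Icc (-(3 * b)) (3 * b))) := ⟨μ 0⟩
  -- By compactness the sequence converges along a nonprincipal ultrafilter; no subsequence has to
  -- be chosen.
  set ρ := ((Filter.hyperfilter ℕ).map μ).lim
  have hρ : Filter.Tendsto μ (Filter.hyperfilter ℕ) (nhds ρ) :=
    Ultrafilter.le_nhds_lim ((Filter.hyperfilter ℕ).map μ)
  have hint : ∀ n, ∫ y, (poissonPoly α q n).eval (y : ℝ)
      ∂(ρ : Measure (Set.Icc (-(3 * b)) (3 * b))) = if n = 0 then 1 else 0 := fun n => by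
    have h1 := (ProbabilityMeasure.tendsto_iff_forall_integral_tendsto.1 hρ)
      (BoundedContinuousFunction.mkOfCompact
        ⟨fun y : Set.Icc (-(3 * b)) (3 * b) => (poissonPoly α q n).eval (y : ℝ), by fun_prop⟩)
    -- For fixed `n` the integral of `P_n` against `μ N` is constant once `N ≥ n`.
    refine tendsto_nhds_unique h1 (tendsto_const_nhds.congr' ?_)
    refine Filter.Eventually.filter_mono Nat.hyperfilter_le_atTop ?_
    filter_upwards [Filter.eventually_ge_atTop n] with N hN
    exact (hμ N n hN).symm
  have hemb : MeasurableEmbedding (Subtype.val : Set.Icc (-(3 * b)) (3 * b) → ℝ) :=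
    MeasurableEmbedding.subtype_coe measurableSet_Icc
  have hsupp : ∀ᵐ y ∂(ρ : Measure (Set.Icc (-(3 * b)) (3 * b))).map Subtype.val, |y| ≤ 3 * b := by
    rw [hemb.ae_map_iff]
    exact Filter.Eventually.of_forall fun y => abs_le.2 y.2
  have hprob : IsProbabilityMeasure ((ρ : Measure (Set.Icc (-(3 * b)) (3 * b))).map Subtype.val) :=
    Measure.isProbabilityMeasure_map hemb.measurable.aemeasurable
  refine ⟨3 * b, _, by linarith, hsupp, (isPoissonMeasure_iff _ _ _).2 ⟨hprob, fun n => ?_,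
    fun n => ?_⟩⟩
  · refine Integrable.of_bound (by fun_prop) ((3 * b) ^ n) ?_
    filter_upwards [hsupp] with y hy
    rw [norm_pow, Real.norm_eq_abs]
    exact pow_le_pow_left₀ (abs_nonneg _) hy n
  · rw [hemb.integral_map]
    exact hint n

lemma existsUnique_isPoissonMeasure {α q : ℝ} (hα : α ∈ Set.Ioo (-1 : ℝ) 1)
    (hq : q ∈ Set.Ioo (-1 : ℝ) 1) : ∃! μ : Measure ℝ, IsPoissonMeasure α q μ := by
  obtain ⟨c, μ, hc, hμc, hμ⟩ := exists_measure_poissonPoly hα hq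
  refine ⟨μ, hμ, fun ν hν => ?_⟩
  obtain ⟨hμp, hμi, hμ⟩ := (isPoissonMeasure_iff _ _ _).1 hμ
  obtain ⟨hνp, hνi, hν⟩ := (isPoissonMeasure_iff _ _ _).1 hν
  have h : polyIntegral ν hνi = polyIntegral μ hμi :=
    linearMap_ext_poissonPoly α q fun n => (hν n).trans (hμ n).symm
  have h' : ∀ p : ℝ[X], ∫ y, p.eval y ∂ν = ∫ y, p.eval y ∂μ := fun p => LinearMap.congr_fun h p
  -- No compact support is assumed of `ν`: its even moments are those of `μ`, hence at most `c ^ (2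
  -- * n)`, which confines `ν` to `[-c, c]`.
  refine measure_eq_of_integral_eval_eq (ae_abs_le_of_moments hc hνi fun n => ?_) hμc hνi hμi h'
  have h1 := h' (X ^ (2 * n))
  simp only [eval_pow, eval_X] at h1
  rw [h1]
  have h2 := integral_mono_ae (hμi (2 * n)) (integrable_const (c ^ (2 * n))) (by
    filter_upwards [hμc] with y hy
    rw [← (even_two_mul n).pow_abs]
    exact pow_le_pow_left₀ (abs_nonneg _) hy _)
  simpa using h2

end TypeB

end

theorem mainTheorem6 {H : Type*} [NormedAddCommGroup H] [InnerProductSpace ℂ H] [CompleteSpace H]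
    (α q : ℝ) (hα : α ∈ Set.Ioo (-1 : ℝ) 1) (hq : q ∈ Set.Ioo (-1 : ℝ) 1)
    (J : H →L[ℂ] H) (hJ : IsSelfAdjoint J) (hJJ : ∀ y : H, J (J y) = y)
    (x : H) (hx : ‖x‖ = 1) :
    TypeB.IsAdjointFor α q J (TypeB.creation x) (TypeB.annihilation α q J x) ∧
    (J x = x →
      (∃! μ : MeasureTheory.Measure ℝ, TypeB.IsPoissonMeasure α q μ) ∧
      ∀ μ : MeasureTheory.Measure ℝ,
        TypeB.IsVacuumDistribution α q J
            (TypeB.opB α q J (ContinuousLinearMap.id ℂ H) x) μ ↔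
          TypeB.IsPoissonMeasure α q μ) ∧
    (J x = -x →
      (∃! μ : MeasureTheory.Measure ℝ, TypeB.IsPoissonMeasure (-α) q μ) ∧
      ∀ μ : MeasureTheory.Measure ℝ,
        TypeB.IsVacuumDistribution α q J
            (TypeB.opB α q J (ContinuousLinearMap.id ℂ H) x) μ ↔
          TypeB.IsPoissonMeasure (-α) q μ) := by
  refine ⟨TypeB.isAdjointFor_creation_annihilation α q J x, fun h => ?_, fun h => ?_⟩
  · refine ⟨TypeB.existsUnique_isPoissonMeasure hα hq, fun μ => ?_⟩
    simpa using TypeB.isVacuumDistribution_iff_isPoissonMeasure α q hx (s := 1) (by simpa using h) μ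
  · have hα' : -α ∈ Set.Ioo (-1 : ℝ) 1 := ⟨by linarith [hα.2], by linarith [hα.1]⟩
    refine ⟨TypeB.existsUnique_isPoissonMeasure hα' hq, fun μ => ?_⟩
    simpa using TypeB.isVacuumDistribution_iff_isPoissonMeasure α q hx (s := -1)
      (by simpa using h) μ
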